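/- Let $G$ be a topological group whose topology is $T_1$ and which is sequential (every sequentially closed subset is closed). A cs*-network at a point $x$ is a family $\mathcal N$ of subsets of $G$ such that for every neighbourhood $U$ of $x$ and every sequence $(x_n)$ converging to $x$ some $N\in\mathcal N$ satisfies $N\subset U$ and contains $x_n$ for infinitely many $n$; the cs*-character of $G$ is the supremum over $x\in G$ of the smallest cardinality of a cs*-network at $x$. Suppose that the cs*-character of $G$ is at most $\aleph_0$. Then: 1. $\psi(G)\le\aleph_0$; 2. $\mathrm{sb}_\chi(G)=\chi(G)\in\{1,\aleph_0,\mathfrak d\}$; 3. $ib(G)=c(G)=d(G)=l(G)=e(G)=nw(G)=knw(G)$; 4. $\mathrm{so}(G)\in\{1,\omega_1\}$. Here: - $\psi(G)$ is the pseudocharacter, the smallest cardinal $\kappa$ such that every one-point set is the intersection of at most $\kappa$ open sets. - $\chi(G)$ is the character, the supremum over $x$ of the smallest cardinality of a neighbourhood base at $x$. - $\mathrm{sb}_\chi(G)$ is the supremum over $x$ of the smallest cardinality of an sb-network at $x$, that is, of a family $\mathcal N$ of sets, each containing all but finitely many terms of every sequence converging to $x$, such that every neighbourhood $U$ of $x$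 contains some $N\in\mathcal N$ with $x\in N$. - $\mathfrak d$ is the cofinality of $\mathbb N^{\omega}$ under the pointwise order. - $ib(G)$ is the smallest cardinal $\kappa$ such that for every nonempty open $U\subset G$ there is $F\subset G$ with $|F|\le\kappa$ and $G=F\cdot U$. - $c(G)$ is the smallest $\kappa$ such that every family of nonempty pairwise disjoint open sets has size at most $\kappa$. - $d(G)$ is the smallest size of a dense subset. - $l(G)$ is the smallest $\kappa$ such that every open cover has a subcover of size at most $\kappa$. - $e(G)$ is the smallest $\kappa$ such that every closed discrete subspace has size at most $\kappa$. - $nw(G)$ is the smallest size of a network, a family $\mathcal N$ of sets such that for every open $U$ and $x\in U$ there is $N\in\mathcal N$ with $x\in N\subset U$. - $knw(G)$ is the smallest size of a $k$-network, a family $\mathcal N$ of sets such that for every open $U$ and compact $K\subset U$ there is a finite $\mathcal M\subset\mathcal N$ with $K\subset\bigcup\mathcal M\subset U$. (Finite values of these invariants are not replaced by $\aleph_0$.) - $\mathrm{so}(G)$ is the sequential order, the smallest ordinal $\alpha\ge 1$ such that $A^{(\alpha+1)}=A^{(\alpha)}$ for all $A\subset G$, where $A^{(0)}=A$ and, for $\alpha>0$,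 $A^{(\alpha)}$ is the set of all limits of convergent sequences contained in some $A^{(\beta)}$, $\beta<\alpha$. -/

import Mathlib

open Set Filter Topology
open scoped Cardinal Ordinal Pointwise

universe u

noncomputable section

namespace CsStar

variable (X : Type u) [TopologicalSpace X]

/-- A family of sets is a network at `x` if every neighbourhood `U` of `x` contains a member
`N` of the family with `x ∈ N`. -/
def IsNetworkAt {X : Type u} [TopologicalSpace X] (𝒩 : Set (Set X)) (x : X) : Prop :=
  ∀ U ∈ 𝓝 x, ∃ N ∈ 𝒩, x ∈ N ∧ N ⊆ U

/-- `B` is a sequential barrier at `x`: every sequence converging to `x` is eventually in `B`. -/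
def IsSeqBarrier {X : Type u} [TopologicalSpace X] (B : Set X) (x : X) : Prop :=
  ∀ s : ℕ → X, Tendsto s atTop (𝓝 x) → ∃ m, ∀ n ≥ m, s n ∈ B

/-- An sb-network at `x`: a network at `x` consisting of sequential barriers at `x`. -/
def IsSbNetworkAt {X : Type u} [TopologicalSpace X] (𝒩 : Set (Set X)) (x : X) : Prop :=
  IsNetworkAt 𝒩 x ∧ ∀ N ∈ 𝒩, IsSeqBarrier N x

/-- A cs*-network at `x`: for every neighbourhood `U` of `x` and every sequence converging to `x`,
some member of the family lies in `U` and contains infinitely many terms of the sequence. -/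
def IsCsStarNetworkAt {X : Type u} [TopologicalSpace X] (𝒩 : Set (Set X)) (x : X) : Prop :=
  ∀ U ∈ 𝓝 x, ∀ s : ℕ → X, Tendsto s atTop (𝓝 x) →
    ∃ N ∈ 𝒩, N ⊆ U ∧ {n : ℕ | s n ∈ N}.Infinite

/-- A base of open neighbourhoods at `x`. -/
def IsNhdsBaseAt {X : Type u} [TopologicalSpace X] (ℬ : Set (Set X)) (x : X) : Prop :=
  (∀ B ∈ ℬ, IsOpen B ∧ x ∈ B) ∧ ∀ U ∈ 𝓝 x, ∃ B ∈ ℬ, B ⊆ U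

/-- The sb-character of a (nonempty) space. -/
def sbCharacter : Cardinal.{u} :=
  ⨆ x : X, sInf {κ | ∃ 𝒩 : Set (Set X), IsSbNetworkAt 𝒩 x ∧ #𝒩 = κ}

/-- The cs*-character of a (nonempty) space. -/
def csStarCharacter : Cardinal.{u} :=
  ⨆ x : X, sInf {κ | ∃ 𝒩 : Set (Set X), IsCsStarNetworkAt 𝒩 x ∧ #𝒩 = κ}

/-- The character `χ(X)`. -/
def character : Cardinal.{u} :=
  ⨆ x : X, sInf {κ | ∃ ℬ : Set (Set X), IsNhdsBaseAt ℬ x ∧ #ℬ = κ}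

/-- The pseudocharacter `ψ(X)`. -/
def pseudocharacter : Cardinal.{u} :=
  sInf {κ | ∀ x : X, ∃ 𝒰 : Set (Set X), (∀ U ∈ 𝒰, IsOpen U) ∧ ⋂₀ 𝒰 = {x} ∧ #𝒰 ≤ κ}

/-- The cellularity `c(X)`. -/
def cellularity : Cardinal.{u} :=
  sInf {κ | ∀ 𝒰 : Set (Set X), (∀ U ∈ 𝒰, IsOpen U ∧ U.Nonempty) →
    𝒰.PairwiseDisjoint id → #𝒰 ≤ κ}

/-- The Lindelöf number `l(X)`. -/
def lindelofNumber : Cardinal.{u} :=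
  sInf {κ | ∀ 𝒰 : Set (Set X), (∀ U ∈ 𝒰, IsOpen U) → ⋃₀ 𝒰 = univ →
    ∃ 𝒱 ⊆ 𝒰, ⋃₀ 𝒱 = univ ∧ #𝒱 ≤ κ}

/-- The density `d(X)`. -/
def density : Cardinal.{u} :=
  sInf {κ | ∃ D : Set X, Dense D ∧ #D = κ}

/-- The extent `e(X)`. -/
def extent : Cardinal.{u} :=
  sInf {κ | ∀ D : Set X, IsClosed D → DiscreteTopology D → #D ≤ κ}

/-- A topological network of `X`. -/
def IsNetwork {X : Type u} [TopologicalSpace X] (𝒩 : Set (Set X)) : Prop :=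
  ∀ U : Set X, IsOpen U → ∀ x ∈ U, ∃ N ∈ 𝒩, x ∈ N ∧ N ⊆ U

/-- The network weight `nw(X)`. -/
def networkWeight : Cardinal.{u} :=
  sInf {κ | ∃ 𝒩 : Set (Set X), IsNetwork 𝒩 ∧ #𝒩 = κ}

/-- A `k`-network of `X`. -/
def IsKNetwork {X : Type u} [TopologicalSpace X] (𝒩 : Set (Set X)) : Prop :=
  ∀ U : Set X, IsOpen U → ∀ K : Set X, IsCompact K → K ⊆ U →
    ∃ ℳ ⊆ 𝒩, ℳ.Finite ∧ K ⊆ ⋃₀ ℳ ∧ ⋃₀ ℳ ⊆ U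

/-- The `k`-network weight `knw(X)`. -/
def kNetworkWeight : Cardinal.{u} :=
  sInf {κ | ∃ 𝒩 : Set (Set X), IsKNetwork 𝒩 ∧ #𝒩 = κ}

/-- The boundedness index `ib(G)` of a topological group. -/
def boundednessIndex (G : Type u) [Group G] [TopologicalSpace G] : Cardinal.{u} :=
  sInf {κ | ∀ U : Set G, IsOpen U → U.Nonempty → ∃ F : Set G, #F ≤ κ ∧ F * U = univ}

/-- The transfinite sequential closures of `A`: the `0`-th one is `A` and, for `α > 0`, the
`α`-th one is the union over `β < α` of the sequential closures of the `β`-th ones (see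
`iterSeqClosure_zero` and `iterSeqClosure_of_ne_zero`). -/
def iterSeqClosure {X : Type u} [TopologicalSpace X] (A : Set X) (α : Ordinal.{u}) : Set X :=
  A ∪ ⋃ β : Iio α, seqClosure (iterSeqClosure A β.1)
termination_by α
decreasing_by exact β.2

theorem iterSeqClosure_zero {X : Type u} [TopologicalSpace X] (A : Set X) :
    iterSeqClosure A 0 = A := by
  rw [iterSeqClosure]
  simp

theorem iterSeqClosure_of_ne_zero {X : Type u} [TopologicalSpace X] (A : Set X)
    {α : Ordinal.{u}} (hα : α ≠ 0) :
    iterSeqClosure A α = ⋃ β : Iio α, seqClosure (iterSeqClosure A β.1) := by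
  conv_lhs => rw [iterSeqClosure]
  refine union_eq_self_of_subset_left fun a ha => ?_
  refine mem_iUnion.2 ⟨⟨0, pos_iff_ne_zero.2 hα⟩, ?_⟩
  rw [iterSeqClosure_zero]
  exact subset_seqClosure ha

/-- The sequential order `so(X)`: the smallest ordinal `α ≥ 1` such that the `α`-th and the
`(α + 1)`-st sequential closures of every subset coincide. -/
def sequentialOrder : Ordinal.{u} :=
  sInf {α | 1 ≤ α ∧ ∀ A : Set X, iterSeqClosure A (α + 1) = iterSeqClosure A α}

/-- The cardinal `𝔡`: the cofinality of the set of functions `ℕ → ℕ` ordered pointwise. -/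
def dominatingNumber : Cardinal.{u} :=
  Cardinal.lift.{u} (Order.cof (ℕ → ℕ))

end CsStar

end

/-!
# Sequential topological groups of countable cs*-character

Let `G` be a sequential `T₁` group with a countable cs*-network `N 0, N 1, …` at `1`. Everything
rests on a dichotomy: `G` is first countable, or an open subgroup of `G` is the union of an
increasing sequence of sequentially compact second countable sets `L n` which determines its
topology (`IsExhaustion`, `exists_isExhaustion`).

The two cases are separated by whether countably many sequential barriers at `1` shrink to `1`
(`CountablyBarriered`). If so, `G` is first countable: the sequential interior of a barrier is
open, because products of two sequences converging to `1` converge to `1`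
(`CountablyBarriered.exists_nhds_basis`). If not, `exists_fan` gives an absorbing sequence of sets
`T k` made of members of the network, and for each `k` a sequence converging to `1` that is almost
disjoint from all translates of `T k`. Since the quotients of far terms of any convergent sequence
lie in a single `T k`, a suitable diagonal sequence through the fan has no convergent subsequence.
Applied inside a sequentially compact set, this shows that such a set is countably barriered, hence
first countable at `1`, and, by total boundedness, second countable. Applied to the fan multiplied
by sequences without cluster points, it shows that the members of the network near `1` have
sequentially compact closures (`exists_nhds_isSeqCompact_closure`); their finite products are
the sets `L n`.

In the first countable case the invariants are computed directly. In the other case every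
sequence converging to `1` has a tail in some `L n`, while for each `n` some sequence converging to
`1` avoids `L n`.
* Countable neighbourhood bases at `1` of the sets `L n` give `ψ(G) ≤ ℵ₀`. Multiplying members of
  these bases gives a neighbourhood base of `G` indexed by `ℕ → ℕ`, so `χ(G) ≤ 𝔡`. Conversely, the
  sequences avoiding the sets `L n` turn an sb-network into a dominating family.
* The inequality `knw(G) ≤ ib(G)` closes the cycle of the easy inequalities between the global
  invariants. It holds since a compact subset of the subgroup lies in one `L n`, so that the
  translates of countable bases of the sets `L n` by a net form a `k`-network.
* Gluing along the sequences that avoid the sets `L n` yields, by induction on `α < ω₁`, sets from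
  which `1` is reached after exactly `α + 1` sequential closures
  (`exists_iterSeqClosure_rank`), so `so(G) = ω₁`.
-/

namespace CsStar

/-! ### Sequences built by recursion -/

/-- Dependent choice along `ℕ`: every new term may be chosen in terms of the finitely many terms
that precede it, and the conditions may depend on the position. -/
theorem exists_seq_of_forall_finset {α : Type*} (Q : ℕ → α → Prop) (R : ℕ → α → α → Prop)
    (h : ∀ (n : ℕ) (s : Finset α), ∃ y, Q n y ∧ ∀ x ∈ s, R n x y) :
    ∃ f : ℕ → α, (∀ n, Q n (f n)) ∧ ∀ m n, m < n → R n (f m) (f n) := by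
  classical
  choose F hF using h
  let g : ℕ → Finset α := fun n => Nat.rec ∅ (fun k s => insert (F k s) s) n
  have hg : ∀ n, g (n + 1) = insert (F n (g n)) (g n) := fun n => rfl
  have hmem : ∀ m n, m < n → F m (g m) ∈ g n := by
    intro m n hmn
    induction n with
    | zero => omega
    | succ k ih =>
      rw [hg]
      rcases Nat.lt_succ_iff_lt_or_eq.1 hmn with h | rfl
      · exact Finset.mem_insert_of_mem (ih h)
      · exact Finset.mem_insert_self _ _
  exact ⟨fun n => F n (g n), fun n => (hF n _).1, fun m n hmn => (hF n _).2 _ (hmem m n hmn)⟩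

section Fans

/-- The union of those of the sets `N 0, …, N k` that lie in `U`. -/
def partUnion {X : Type u} (N : ℕ → Set X) (U : Set X) (k : ℕ) : Set X :=
  {x | ∃ i ≤ k, N i ⊆ U ∧ x ∈ N i}

theorem partUnion_mono {X : Type u} (N : ℕ → Set X) (U : Set X) : Monotone (partUnion N U) :=
  fun _ _ hkl _ ⟨i, hi, h⟩ => ⟨i, hi.trans hkl, h⟩

variable {G : Type u} [Group G] [TopologicalSpace G]

/-! ### Sequential barriers at the identity -/

/-- `B` contains a tail of every sequence of points of `L` that converges to `1`; for `L = univ`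
this says that `B` is a sequential barrier at `1`. -/
def IsSeqBarrierIn (L B : Set G) : Prop :=
  ∀ s : ℕ → G, (∀ n, s n ∈ L) → Tendsto s atTop (𝓝 1) → ∀ᶠ n in atTop, s n ∈ B

/-- Countably many sequential barriers at `1` relative to `L` suffice to get into every
neighbourhood of `1`. -/
def CountablyBarriered (L : Set G) : Prop :=
  ∃ B : ℕ → Set G, (∀ n, IsSeqBarrierIn L (B n)) ∧ ∀ U ∈ 𝓝 (1 : G), ∃ n, B n ⊆ U

/-- A sequence of sets is absorbing if each sequence converging to `1` has a tail in one of
them. -/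
def IsAbsorbing (T : ℕ → Set G) : Prop :=
  ∀ s : ℕ → G, Tendsto s atTop (𝓝 1) → ∃ k, ∀ᶠ n in atTop, s n ∈ T k

theorem CountablyBarriered.exists_antitone {L : Set G} (h : CountablyBarriered L) :
    ∃ B : ℕ → Set G, Antitone B ∧ (∀ n, IsSeqBarrierIn L (B n)) ∧
      ∀ U ∈ 𝓝 (1 : G), ∃ n, B n ⊆ U := by
  obtain ⟨B, hB, hU⟩ := h
  refine ⟨fun n => ⋂ i ∈ Iic n, B i, ?_, ?_, ?_⟩
  · intro m n hmn
    exact biInter_subset_biInter_left (Iic_subset_Iic.2 hmn)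
  · intro n s hs h1
    simp only [mem_iInter]
    exact (eventually_all_finite (finite_Iic n)).2 fun i _ => hB i s hs h1
  · intro U hUn
    obtain ⟨n, hn⟩ := hU U hUn
    exact ⟨n, (biInter_subset_of_mem (mem_Iic.2 le_rfl)).trans hn⟩

/-- Finite unions of members of a countable cs*-network absorb whole tails of sequences. -/
theorem isAbsorbing_partUnion {N : ℕ → Set G} (hN : IsCsStarNetworkAt (range N) 1)
    {U : Set G} (hU : U ∈ 𝓝 (1 : G)) : IsAbsorbing (partUnion N U) := by
  intro s hs
  by_contra! hcon
  obtain ⟨φ, hφ, hφs⟩ := extraction_forall_of_frequently (P := fun k n => s n ∉ partUnion N U k)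
    (fun k => by simpa [Filter.Frequently] using hcon k)
  obtain ⟨_, ⟨i, rfl⟩, hiU, hinf⟩ := hN U hU (s ∘ φ) (hs.comp hφ.tendsto_atTop)
  obtain ⟨k, hk, hik⟩ := hinf.exists_gt i
  exact hφs k ⟨i, hik.le, hiU, hk⟩

variable [IsTopologicalGroup G]

/-- An absorbing increasing sequence of sets catches the quotients of far terms of a convergent
sequence. -/
theorem IsAbsorbing.exists_inv_mul_mem {T : ℕ → Set G} (hT : IsAbsorbing T) (hm : Monotone T)
    {x : ℕ → G} {a : G} (hx : Tendsto x atTop (𝓝 a)) :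
    ∃ m n, ∀ k ≥ n, ∀ l ≥ n, (x k)⁻¹ * x l ∈ T m := by
  by_contra! hcon
  choose k hk l hl hkl using fun m => hcon m m
  have hk' : Tendsto k atTop atTop := tendsto_atTop_mono hk tendsto_id
  have hl' : Tendsto l atTop atTop := tendsto_atTop_mono hl tendsto_id
  have h1 : Tendsto (fun m => (x (k m))⁻¹ * x (l m)) atTop (𝓝 1) := by
    simpa using (hx.comp hk').inv.mul (hx.comp hl')
  obtain ⟨p, hp⟩ := hT _ h1
  obtain ⟨m, hm1, hm2⟩ := (hp.and (eventually_ge_atTop p)).exists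
  exact hkl m (hm hm2 hm1)

theorem exists_isOpen_closure_inv_mul_subset {U : Set G} (hU : U ∈ 𝓝 (1 : G)) :
    ∃ V : Set G, IsOpen V ∧ 1 ∈ V ∧ closure (V⁻¹ * V) ⊆ U := by
  obtain ⟨C, hC, hCc, hCU⟩ := exists_mem_nhds_isClosed_subset hU
  have h : Tendsto (fun p : G × G => p.1⁻¹ * p.2) (𝓝 (1, 1)) (𝓝 1) := by
    have : Continuous fun p : G × G => p.1⁻¹ * p.2 := by fun_prop
    simpa using this.tendsto (1, 1)
  have h2 := h hC
  rw [mem_map, nhds_prod_eq, mem_prod_same_iff] at h2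
  obtain ⟨W, hW, hWC⟩ := h2
  obtain ⟨V, hVW, hVo, hV1⟩ := mem_nhds_iff.1 hW
  refine ⟨V, hVo, hV1, (closure_minimal ?_ hCc).trans hCU⟩
  rintro _ ⟨a, ha, b, hb, rfl⟩
  have := @hWC (a⁻¹, b) ⟨hVW ha, hVW hb⟩
  simpa using this

/-- If `L` is not countably barriered then there are an absorbing sequence `T` and sequences in `L`
converging to `1`, the `k`-th of them almost disjoint from all translates of `T k`. Translates
come for free because two terms `x`, `y` of a sequence in `c • N` satisfy `x⁻¹ * y ∈ N⁻¹ * N`,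
whence, `x` tending to `1`, all terms lie in `closure (N⁻¹ * N)`, a set that does not depend
on `c`. -/
theorem exists_fan {N : ℕ → Set G} (hN : IsCsStarNetworkAt (range N) 1) (hN0 : N 0 = {1})
    {L : Set G} (hL : ¬ CountablyBarriered L) :
    ∃ T : ℕ → Set G, Monotone T ∧ IsAbsorbing T ∧ (∀ k, 1 ∈ T k) ∧
      ∃ S : ℕ → ℕ → G, (∀ k j, S k j ∈ L) ∧ (∀ k, Tendsto (S k) atTop (𝓝 1)) ∧
        ∀ k c, ∀ᶠ j in atTop, c⁻¹ * S k j ∉ T k := by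
  let Q : Finset ℕ → Set G := fun I => ⋃ i ∈ I, closure ((N i)⁻¹ * N i)
  obtain ⟨U, hU, hUQ⟩ : ∃ U ∈ 𝓝 (1 : G), ∀ I, Q I ⊆ U → ¬ IsSeqBarrierIn L (Q I) := by
    by_contra! hcon
    obtain ⟨I₀, -, hI₀⟩ := hcon univ univ_mem
    obtain ⟨e, he⟩ := exists_surjective_nat (Finset ℕ)
    classical
    refine hL ⟨fun n => if IsSeqBarrierIn L (Q (e n)) then Q (e n) else Q I₀, fun n => ?_, ?_⟩
    · dsimp only
      split_ifs with h
      exacts [h, hI₀]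
    · intro U hU
      obtain ⟨I, hI, hIb⟩ := hcon U hU
      obtain ⟨n, rfl⟩ := he I
      exact ⟨n, by simpa [hIb] using hI⟩
  obtain ⟨V, hVo, hV1, hVU⟩ := exists_isOpen_closure_inv_mul_subset hU
  classical
  let I : ℕ → Finset ℕ := fun k => (Finset.range (k + 1)).filter fun i => N i ⊆ V
  have hQ : ∀ k, ¬ IsSeqBarrierIn L (Q (I k)) := by
    intro k
    refine hUQ _ (iUnion₂_subset fun i hi => ?_)
    have hi' : N i ⊆ V := (Finset.mem_filter.1 hi).2
    exact (closure_mono (mul_subset_mul (inv_subset_inv.2 hi') hi')).trans hVU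
  have hS : ∀ k, ∃ s : ℕ → G, (∀ j, s j ∈ L) ∧ Tendsto s atTop (𝓝 1) ∧ ∀ j, s j ∉ Q (I k) := by
    intro k
    have := hQ k
    unfold IsSeqBarrierIn at this
    push Not at this
    obtain ⟨s, hsL, hs, hf⟩ := this
    obtain ⟨φ, hφ, hφs⟩ := extraction_of_frequently_atTop hf
    exact ⟨s ∘ φ, fun j => hsL _, hs.comp hφ.tendsto_atTop, hφs⟩
  choose S hSL hS1 hSQ using hS
  refine ⟨partUnion N V, partUnion_mono N V, isAbsorbing_partUnion hN (hVo.mem_nhds hV1),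
    fun k => ⟨0, k.zero_le, by simpa [hN0] using hV1, by simp [hN0]⟩, S, hSL, hS1, ?_⟩
  intro k c
  by_contra hf
  have hf' : ∃ᶠ j in atTop, ∃ i ∈ I k, c⁻¹ * S k j ∈ N i := by
    refine (not_eventually.1 hf).mono fun j hj => ?_
    obtain ⟨i, hik, hiV, hi⟩ := not_not.1 hj
    exact ⟨i, Finset.mem_filter.2 ⟨Finset.mem_range.2 (by omega), hiV⟩, hi⟩
  obtain ⟨i, hi, hf'⟩ : ∃ i ∈ I k, ∃ᶠ j in atTop, c⁻¹ * S k j ∈ N i := by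
    by_contra! hcon
    refine hf' ?_
    have := (eventually_all_finset (I k)).2 fun i hi => hcon i hi
    filter_upwards [this] with j hj
    simpa using hj
  obtain ⟨φ, hφ, hφN⟩ := extraction_of_frequently_atTop hf'
  refine hSQ k (φ 0) (mem_biUnion hi ?_)
  have ht : Tendsto (fun n => (S k (φ n))⁻¹ * S k (φ 0)) atTop (𝓝 (1⁻¹ * S k (φ 0))) :=
    ((hS1 k).comp hφ.tendsto_atTop).inv.mul_const _
  rw [inv_one, one_mul] at ht
  refine mem_closure_of_tendsto ht (Eventually.of_forall fun n => ?_)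
  refine ⟨(c⁻¹ * S k (φ n))⁻¹, inv_mem_inv.2 (hφN n), c⁻¹ * S k (φ 0), hφN 0, ?_⟩
  simp [mul_assoc]

/-- A sequentially compact set is countably barriered: otherwise a diagonal sequence through the
fan of `exists_fan` would have no convergent subsequence. -/
theorem countablyBarriered_of_isSeqCompact {N : ℕ → Set G} (hN : IsCsStarNetworkAt (range N) 1)
    (hN0 : N 0 = {1}) {L : Set G} (hL : IsSeqCompact L) : CountablyBarriered L := by
  by_contra hcon
  obtain ⟨T, hTm, hT, -, S, hSL, -, hST⟩ := exists_fan hN hN0 hcon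
  obtain ⟨x, hxL, hx⟩ := exists_seq_of_forall_finset (fun _ y => y ∈ L)
    (fun k p y => p⁻¹ * y ∉ T k) (fun k s => by
      obtain ⟨j, hj⟩ := ((eventually_all_finset s).2 fun c _ => hST k c).exists
      exact ⟨S k j, hSL k j, hj⟩)
  obtain ⟨a, -, φ, hφ, ha⟩ := hL hxL
  obtain ⟨m, n, hmn⟩ := hT.exists_inv_mul_mem hTm ha
  obtain ⟨l, hl1, hl2⟩ : ∃ l, n < l ∧ m ≤ φ l :=
    ⟨max (n + 1) m, by omega, (le_max_right _ _).trans hφ.le_apply⟩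
  exact hx _ _ (hφ hl1) (hTm hl2 (hmn n le_rfl l hl1.le))

/-- If `1` has no countable family of sequential barriers shrinking to it, then the members of the
cs*-network close to `1` have sequentially compact closures. Otherwise sequences without
convergent subsequences accumulate at `1`; multiplying them termwise with the fan of `exists_fan`
produces a sequentially closed set that has `1` in its closure but not as an element. -/
theorem exists_nhds_isSeqCompact_closure [SequentialSpace G] [T2Space G] {N : ℕ → Set G}
    (hN : IsCsStarNetworkAt (range N) 1) (hN0 : N 0 = {1})
    (hG : ¬ CountablyBarriered (univ : Set G)) :
    ∃ U ∈ 𝓝 (1 : G), ∀ i, N i ⊆ U → IsSeqCompact (closure (N i)) := by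
  by_contra! hcon
  obtain ⟨T, hTm, hT, hT1, S, -, hS1, hST⟩ := exists_fan hN hN0 hG
  have hd : ∀ i, ∃ d : ℕ → G, ¬ IsSeqCompact (closure (N i)) →
      (∀ j, d j ∈ closure (N i)) ∧
        ∀ (a : G) (φ : ℕ → ℕ), StrictMono φ → ¬ Tendsto (d ∘ φ) atTop (𝓝 a) := by
    intro i
    by_cases hi : IsSeqCompact (closure (N i))
    · exact ⟨fun _ => 1, fun h => absurd hi h⟩
    · have hi' := hi
      unfold IsSeqCompact at hi'
      push Not at hi'
      obtain ⟨d, hd, h⟩ := hi'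
      refine ⟨d, fun _ => ⟨hd, fun a φ hφ ha => ?_⟩⟩
      exact h a (isClosed_closure.mem_of_tendsto ha (Eventually.of_forall fun n => hd _)) φ hφ ha
  choose d hd using hd
  classical
  -- The pair `(i, j)` with code `l` is given the point `x l = d i j * S i (r l)`.
  let i : ℕ → ℕ := fun l => l.unpair.1
  let j : ℕ → ℕ := fun l => l.unpair.2
  obtain ⟨y, hyQ, hyR⟩ := exists_seq_of_forall_finset
    (fun l (y : G) => (∃ r ≥ j l, y = d (i l) (j l) * S (i l) r) ∧ y ∉ T (i l))
    (fun l p y => p⁻¹ * y ∉ T (i l)) (fun l s => by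
      have h1 := (eventually_all_finset (insert 1 s)).2
        fun p _ => hST (i l) ((d (i l) (j l))⁻¹ * p)
      obtain ⟨r, hr, hrj⟩ := (h1.and (eventually_ge_atTop (j l))).exists
      refine ⟨_, ⟨⟨r, hrj, rfl⟩, ?_⟩, fun p hp => ?_⟩
      · simpa [mul_assoc] using hr 1 (Finset.mem_insert_self _ _)
      · simpa [mul_assoc] using hr p (Finset.mem_insert_of_mem hp))
  choose hyr hy1 using hyQ
  choose r hrj hyr using hyr
  let A : Set G := {a | ∃ l, ¬ IsSeqCompact (closure (N (i l))) ∧ a = y l}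
  have h1A : (1 : G) ∉ A := by
    rintro ⟨l, -, h⟩
    exact hy1 l (h ▸ hT1 _)
  have h1cl : (1 : G) ∈ closure A := by
    rw [mem_closure_iff_nhds]
    intro W hW
    obtain ⟨V, hVo, hV1, hVW⟩ := exists_open_nhds_one_mul_subset hW
    obtain ⟨C, hC, hCc, hCV⟩ := exists_mem_nhds_isClosed_subset (hVo.mem_nhds hV1)
    obtain ⟨n, hnC, hn⟩ := hcon C hC
    have hdV : ∀ k, d n k ∈ V := fun k => hCV (closure_minimal hnC hCc ((hd n hn).1 k))
    obtain ⟨k, hk⟩ := eventually_atTop.1 ((hS1 n).eventually (hVo.mem_nhds hV1))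
    have hi : i (Nat.pair n k) = n := by simp [i]
    have hj : j (Nat.pair n k) = k := by simp [j]
    refine ⟨y (Nat.pair n k), hVW ?_, Nat.pair n k, by rwa [hi], rfl⟩
    rw [hyr, hi, hj]
    refine mul_mem_mul (hdV k) (hk _ ?_)
    simpa [hj] using hrj (Nat.pair n k)
  have hAc : IsSeqClosed A := by
    intro z a hz hza
    choose l hlb hzl using hz
    by_contra haA
    have hne : ∀ p, a ≠ y (l p) := fun p h => haA ⟨l p, hlb p, h⟩
    obtain rfl : z = fun p => y (l p) := funext hzl
    have hl : Tendsto l atTop atTop := by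
      refine tendsto_atTop.2 fun b => ?_
      by_contra hb
      obtain ⟨c, -, hc⟩ : ∃ c ∈ Finset.range b, ∃ᶠ p in atTop, l p = c := by
        by_contra! hcon
        refine hb ?_
        filter_upwards [(eventually_all_finset (Finset.range b)).2 hcon] with p hp
        by_contra! hlt
        exact hp _ (Finset.mem_range.2 hlt) rfl
      obtain ⟨p, hp⟩ := hc.exists
      have hev := hza.eventually_ne (hne p)
      exact hc (hev.mono fun q hq h => hq (by rw [h, hp]))
    obtain ⟨φ, hφ, hlφ⟩ := strictMono_subseq_of_tendsto_atTop hl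
    have hφa := hza.comp hφ.tendsto_atTop
    obtain ⟨m, n, hmn⟩ := hT.exists_inv_mul_mem hTm hφa
    have hbound : ∀ p > n, i (l (φ p)) < m := by
      intro p hp
      by_contra! hle
      exact hyR _ _ (hlφ hp) (hTm hle (hmn n le_rfl p hp.le))
    obtain ⟨c, -, hc⟩ : ∃ c ∈ Finset.range m, ∃ᶠ p in atTop, i (l (φ p)) = c := by
      by_contra! hcon
      obtain ⟨p, hp, hpn⟩ := (((eventually_all_finset (Finset.range m)).2 hcon).and
        (eventually_gt_atTop n)).exists
      exact hp _ (Finset.mem_range.2 (hbound p hpn)) rfl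
    obtain ⟨ψ, hψ, hψc⟩ := extraction_of_frequently_atTop hc
    have hjm : StrictMono fun p => j (l (φ (ψ p))) := by
      intro p q hpq
      have h := hlφ (hψ hpq)
      by_contra! hle
      rw [Function.comp, Function.comp, ← Nat.pair_unpair (l (φ (ψ p))),
        ← Nat.pair_unpair (l (φ (ψ q)))] at h
      change Nat.pair (i _) (j _) < Nat.pair (i _) (j _) at h
      rw [hψc, hψc] at h
      rcases hle.lt_or_eq with hlt | heq
      · exact lt_asymm h (Nat.pair_lt_pair_right _ hlt)
      · rw [heq] at h
        exact lt_irrefl _ h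
    have hbad : ¬ IsSeqCompact (closure (N c)) := by
      have := hlb (φ (ψ 0))
      rwa [hψc] at this
    refine (hd c hbad).2 a _ hjm ?_
    have hr : Tendsto (fun p => r (l (φ (ψ p)))) atTop atTop :=
      tendsto_atTop_mono (fun p => hrj _) hjm.tendsto_atTop
    have h1 := (hφa.comp hψ.tendsto_atTop).mul ((hS1 c).comp hr).inv
    rw [inv_one, mul_one] at h1
    refine h1.congr fun p => ?_
    simp only [Function.comp]
    rw [hyr, hψc]
    simp
  exact h1A ((isSeqClosed_iff_isClosed.1 hAc).closure_eq ▸ h1cl)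

end Fans

/-! ### From barriers to neighbourhoods -/

section Barriers

variable {G : Type u} [Group G] [TopologicalSpace G]

theorem IsSeqBarrierIn.mono {L L' B : Set G} (h : IsSeqBarrierIn L' B) (hL : L ⊆ L') :
    IsSeqBarrierIn L B :=
  fun s hs => h s fun n => hL (hs n)

theorem CountablyBarriered.mono {L L' : Set G} (h : CountablyBarriered L') (hL : L ⊆ L') :
    CountablyBarriered L :=
  h.imp fun _ hB => ⟨fun n => (hB.1 n).mono hL, hB.2⟩

variable [IsTopologicalGroup G]

/-- A sequential space which is weakly first countable is first countable if it is a topological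
group: the sequential interiors of the barriers `B n` are open, since for each `m` a product of two
far barriers lies in `B m`. The argument is local enough to be carried out inside a closed
set `L`, provided that the barriers are good for the products of quotients of points of `L`. -/
theorem CountablyBarriered.exists_nhds_basis [SequentialSpace G] {L L₂ : Set G} (hL : IsClosed L)
    (h1 : 1 ∈ L) (hL₂ : L⁻¹ * L ⊆ L₂) (h : CountablyBarriered (L₂ * L₂)) :
    ∃ V : ℕ → Set G, Antitone V ∧ (∀ n, IsOpen (V n) ∧ 1 ∈ V n) ∧
      ∀ U ∈ 𝓝 (1 : G), ∃ n, V n ∩ L ⊆ U := by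
  obtain ⟨B, hBa, hB, hBU⟩ := h.exists_antitone
  have h1₂ : (1 : G) ∈ L₂ := hL₂ ⟨1⁻¹, inv_mem_inv.2 h1, 1, h1, by simp⟩
  have hsub : L₂ ⊆ L₂ * L₂ := fun x hx => ⟨1, h1₂, x, hx, one_mul x⟩
  have hquot : ∀ x ∈ L, ∀ y ∈ L, x⁻¹ * y ∈ L₂ := fun x hx y hy =>
    hL₂ (mul_mem_mul (inv_mem_inv.2 hx) hy)
  have h1B : ∀ m, (1 : G) ∈ B m := fun m =>
    ((hB m) (fun _ => 1) (fun _ => hsub h1₂) tendsto_const_nhds).exists.choose_spec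
  have htend : ∀ a : ℕ → G, (∀ k, a k ∈ B k) → Tendsto a atTop (𝓝 1) := by
    intro a ha
    refine tendsto_def.2 fun U hU => ?_
    obtain ⟨n, hn⟩ := hBU U hU
    filter_upwards [eventually_ge_atTop n] with k hk
    exact hn (hBa hk (ha k))
  have hprod : ∀ m, ∃ k, ∀ a ∈ L₂, ∀ b ∈ L₂, a ∈ B k → b ∈ B k → a * b ∈ B m := by
    intro m
    by_contra! hcon
    choose a ha b hb haB hbB hab using hcon
    have ht : Tendsto (fun k => a k * b k) atTop (𝓝 1) := by
      simpa using (htend a haB).mul (htend b hbB)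
    obtain ⟨k, hk⟩ := (hB m _ (fun k => mul_mem_mul (ha k) (hb k)) ht).exists
    exact hab k hk
  let I : ℕ → Set G := fun n => {x | x ∈ L ∧ ∃ m, ∀ z ∈ L, x⁻¹ * z ∈ B m → z ∈ B n}
  have hIB : ∀ n, I n ⊆ B n := by
    rintro n x ⟨hx, m, hm⟩
    exact hm x hx (by simpa using h1B m)
  have hclosed : ∀ n, IsClosed (L \ I n) := by
    intro n
    refine IsSeqClosed.isClosed fun z x hz hzx => ?_
    refine ⟨hL.mem_of_tendsto hzx (Eventually.of_forall fun k => (hz k).1), ?_⟩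
    rintro ⟨hx, m, hm⟩
    obtain ⟨k, hk⟩ := hprod m
    have ht : Tendsto (fun j => x⁻¹ * z j) atTop (𝓝 1) := by
      simpa using hzx.const_mul x⁻¹
    obtain ⟨j, hj⟩ := (hB k _ (fun j => hsub (hquot x hx _ (hz j).1)) ht).exists
    refine (hz j).2 ⟨(hz j).1, k, fun w hw hwk => hm w hw ?_⟩
    simpa [mul_assoc] using
      hk _ (hquot x hx _ (hz j).1) _ (hquot _ (hz j).1 w hw) hj hwk
  refine ⟨fun n => (L \ I n)ᶜ, ?_, fun n => ⟨(hclosed n).isOpen_compl, ?_⟩, fun U hU => ?_⟩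
  · intro n n' hn
    refine compl_subset_compl.2 (sdiff_subset_sdiff_right ?_)
    rintro x ⟨hx, m, hm⟩
    exact ⟨hx, m, fun z hz h => hBa hn (hm z hz h)⟩
  · exact fun h => h.2 ⟨h1, n, fun z _ hz => by simpa using hz⟩
  · obtain ⟨n, hn⟩ := hBU U hU
    refine ⟨n, fun x hx => hn (hIB n ?_)⟩
    by_contra hxI
    exact hx.1 ⟨hx.2, hxI⟩

end Barriers

/-! ### Exhaustion of an open subgroup by sequentially compact sets -/

/-- An increasing sequence of symmetric sequentially compact sets containing `1`, the products
of two points of each lying in the next, such that every sequence converging to `1` has a tail in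
one of them. Their union is an open subgroup with the topology determined by these sets. -/
structure IsExhaustion {G : Type u} [Group G] [TopologicalSpace G] (L : ℕ → Set G) : Prop where
  monotone : Monotone L
  one_mem : ∀ n, 1 ∈ L n
  inv_mem : ∀ {n : ℕ} {x : G}, x ∈ L n → x⁻¹ ∈ L n
  mul_mem : ∀ {n : ℕ} {x y : G}, x ∈ L n → y ∈ L n → x * y ∈ L (n + 1)
  isSeqCompact : ∀ n, IsSeqCompact (L n)
  isAbsorbing : IsAbsorbing L

section SeqCompact

variable {X Y Z : Type*} [TopologicalSpace X] [TopologicalSpace Y] [TopologicalSpace Z]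

theorem isSeqCompact_singleton (a : X) : IsSeqCompact {a} := fun _ hx =>
  ⟨a, rfl, id, strictMono_id, tendsto_const_nhds.congr fun n => (hx n).symm⟩

theorem isSeqCompact_union {A B : Set X} (hA : IsSeqCompact A) (hB : IsSeqCompact B) :
    IsSeqCompact (A ∪ B) := by
  intro x hx
  have : (∃ᶠ n in atTop, x n ∈ A) ∨ ∃ᶠ n in atTop, x n ∈ B :=
    frequently_or_distrib.1 (Eventually.of_forall hx).frequently
  rcases this with h | h
  · obtain ⟨φ, hφ, hφx⟩ := extraction_of_frequently_atTop h
    obtain ⟨a, ha, ψ, hψ, h⟩ := hA hφx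
    exact ⟨a, Or.inl ha, φ ∘ ψ, hφ.comp hψ, h⟩
  · obtain ⟨φ, hφ, hφx⟩ := extraction_of_frequently_atTop h
    obtain ⟨a, ha, ψ, hψ, h⟩ := hB hφx
    exact ⟨a, Or.inr ha, φ ∘ ψ, hφ.comp hψ, h⟩

theorem isSeqCompact_image2 {A : Set X} {B : Set Y} (hA : IsSeqCompact A) (hB : IsSeqCompact B)
    {f : X → Y → Z} (hf : Continuous fun p : X × Y => f p.1 p.2) :
    IsSeqCompact (image2 f A B) := by
  intro z hz
  choose x hx y hy hxy using hz
  obtain ⟨a, ha, φ, hφ, hφa⟩ := hA hx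
  obtain ⟨b, hb, ψ, hψ, hψb⟩ := hB fun n => hy (φ n)
  refine ⟨f a b, mem_image2_of_mem ha hb, φ ∘ ψ, hφ.comp hψ, ?_⟩
  have h := (hf.tendsto (a, b)).comp ((hφa.comp hψ.tendsto_atTop).prodMk_nhds hψb)
  exact h.congr fun n => hxy _

theorem isClosed_of_isSeqCompact [SequentialSpace X] [T2Space X] {A : Set X}
    (hA : IsSeqCompact A) : IsClosed A := by
  refine IsSeqClosed.isClosed fun x a hx hxa => ?_
  obtain ⟨b, hb, φ, hφ, h⟩ := hA hx
  rwa [tendsto_nhds_unique (hxa.comp hφ.tendsto_atTop) h]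

end SeqCompact

/-- The structural dichotomy: if `1` does not have countably many barriers shrinking to it,
then an open subgroup is exhausted by sequentially compact sets. -/
theorem exists_isExhaustion {G : Type u} [Group G] [TopologicalSpace G] [IsTopologicalGroup G]
    [SequentialSpace G] [T2Space G] {N : ℕ → Set G} (hN : IsCsStarNetworkAt (range N) 1)
    (hN0 : N 0 = {1}) (hG : ¬ CountablyBarriered (univ : Set G)) :
    ∃ L : ℕ → Set G, IsExhaustion L := by
  obtain ⟨U, hU, hUN⟩ := exists_nhds_isSeqCompact_closure hN hN0 hG
  classical
  let J : ℕ → Set G := fun n => if N n ⊆ U then closure (N n) else {1}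
  have hJ : ∀ n, IsSeqCompact (J n) := by
    intro n
    by_cases h : N n ⊆ U
    · simpa [J, h] using hUN n h
    · simp only [J, h, if_false]
      exact isSeqCompact_singleton 1
  let L : ℕ → Set G := fun n =>
    Nat.rec {1} (fun k A => image2 (· * ·) (A ∪ (J k ∪ (J k)⁻¹)) (A ∪ (J k ∪ (J k)⁻¹))) n
  have hL0 : L 0 = {1} := rfl
  have hLs : ∀ k, L (k + 1) =
      image2 (· * ·) (L k ∪ (J k ∪ (J k)⁻¹)) (L k ∪ (J k ∪ (J k)⁻¹)) := fun k => rfl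
  have h1 : ∀ n, (1 : G) ∈ L n := by
    intro n
    induction n with
    | zero => simp [hL0]
    | succ k ih => exact hLs k ▸ ⟨1, Or.inl ih, 1, Or.inl ih, one_mul 1⟩
  have hmul : ∀ {n : ℕ} {x y : G}, x ∈ L n → y ∈ L n → x * y ∈ L (n + 1) := fun {n x y} hx hy =>
    hLs n ▸ ⟨x, Or.inl hx, y, Or.inl hy, rfl⟩
  have hmono : Monotone L :=
    monotone_nat_of_le_succ fun n x hx => by simpa using hmul hx (h1 n)
  refine ⟨L, hmono, h1, ?_, hmul, ?_, ?_⟩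
  · intro n
    induction n with
    | zero => simp [hL0]
    | succ k ih =>
      have hs : ∀ x ∈ L k ∪ (J k ∪ (J k)⁻¹), x⁻¹ ∈ L k ∪ (J k ∪ (J k)⁻¹) := by
        rintro x (hx | hx | hx)
        · exact Or.inl (ih hx)
        · exact Or.inr (Or.inr (inv_mem_inv.2 hx))
        · exact Or.inr (Or.inl hx)
      intro x hx
      rw [hLs] at hx ⊢
      obtain ⟨a, ha, b, hb, rfl⟩ := hx
      exact ⟨b⁻¹, hs b hb, a⁻¹, hs a ha, by simp⟩
  · intro n
    induction n with
    | zero => exact hL0 ▸ isSeqCompact_singleton 1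
    | succ k ih =>
      have hinv : IsSeqCompact (J k)⁻¹ := by
        have := isSeqCompact_image2 (isSeqCompact_singleton (1 : G)) (hJ k)
          (f := fun _ x => x⁻¹) (by fun_prop)
        rwa [image2_singleton_left, image_inv_eq_inv] at this
      have hA := isSeqCompact_union ih (isSeqCompact_union (hJ k) hinv)
      exact hLs k ▸ isSeqCompact_image2 hA hA continuous_mul
  · intro s hs
    obtain ⟨k, hk⟩ := isAbsorbing_partUnion hN hU s hs
    refine ⟨k + 1, hk.mono fun n hn => ?_⟩
    obtain ⟨i, hik, hiU, hi⟩ := hn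
    refine hmono (by omega : i + 1 ≤ k + 1) (hLs i ▸ ⟨1, Or.inl (h1 i), s n, ?_, one_mul _⟩)
    refine Or.inr (Or.inl ?_)
    simpa [J, hiU] using subset_closure hi

namespace IsExhaustion

section

variable {G : Type u} [Group G] [TopologicalSpace G] {L : ℕ → Set G}

theorem inv_mul_mem (hL : IsExhaustion L) {n : ℕ} {x y : G} (hx : x ∈ L n) (hy : y ∈ L n) :
    x⁻¹ * y ∈ L (n + 1) :=
  hL.mul_mem (hL.inv_mem hx) hy

theorem isClosed [SequentialSpace G] [T2Space G] (hL : IsExhaustion L) (n : ℕ) :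
    IsClosed (L n) :=
  isClosed_of_isSeqCompact (hL.isSeqCompact n)

/-- The open subgroup exhausted by the sets `L n`. -/
def subgroup (hL : IsExhaustion L) : Subgroup G where
  carrier := ⋃ n, L n
  mul_mem' := by
    intro a b ha hb
    obtain ⟨m, hm⟩ := mem_iUnion.1 ha
    obtain ⟨n, hn⟩ := mem_iUnion.1 hb
    exact mem_iUnion.2 ⟨_, hL.mul_mem (hL.monotone (le_max_left m n) hm)
      (hL.monotone (le_max_right m n) hn)⟩
  one_mem' := mem_iUnion.2 ⟨0, hL.one_mem 0⟩
  inv_mem' := by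
    intro a ha
    obtain ⟨m, hm⟩ := mem_iUnion.1 ha
    exact mem_iUnion.2 ⟨m, hL.inv_mem hm⟩

theorem mem_subgroup (hL : IsExhaustion L) {x : G} : x ∈ hL.subgroup ↔ ∃ n, x ∈ L n := mem_iUnion

end

variable {G : Type u} [Group G] [TopologicalSpace G] [IsTopologicalGroup G] {L : ℕ → Set G}

theorem eventually_mem (hL : IsExhaustion L) {s : ℕ → G} {x : G} {n : ℕ} (hx : x ∈ L n)
    (hs : Tendsto s atTop (𝓝 x)) : ∃ p, ∀ᶠ k in atTop, s k ∈ L p := by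
  have h : Tendsto (fun k => x⁻¹ * s k) atTop (𝓝 1) := by simpa using hs.const_mul x⁻¹
  obtain ⟨q, hq⟩ := hL.isAbsorbing _ h
  refine ⟨max n q + 1, hq.mono fun k hk => ?_⟩
  simpa using hL.mul_mem (hL.monotone (le_max_left n q) hx) (hL.monotone (le_max_right n q) hk)

theorem isOpen_subgroup [SequentialSpace G] (hL : IsExhaustion L) :
    IsOpen (hL.subgroup : Set G) := by
  rw [← isClosed_compl_iff]
  refine IsSeqClosed.isClosed fun s x hs hsx hx => ?_
  obtain ⟨n, hn⟩ := hL.mem_subgroup.1 hx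
  obtain ⟨p, hp⟩ := hL.eventually_mem hn hsx
  obtain ⟨k, hk⟩ := hp.exists
  exact hs k (hL.mem_subgroup.2 ⟨p, hk⟩)

theorem isClosed_subgroup [SequentialSpace G] (hL : IsExhaustion L) :
    IsClosed (hL.subgroup : Set G) :=
  hL.subgroup.isClosed_of_isOpen hL.isOpen_subgroup

/-- A convergent sequence of points of the subgroup has a tail in some `L p`. -/
theorem eventually_mem_of_mem_subgroup [SequentialSpace G] (hL : IsExhaustion L) {s : ℕ → G}
    {x : G} (h : ∀ k, s k ∈ hL.subgroup) (hs : Tendsto s atTop (𝓝 x)) :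
    ∃ p, ∀ᶠ k in atTop, s k ∈ L p := by
  obtain ⟨n, hn⟩ := hL.mem_subgroup.1
    (hL.isClosed_subgroup.mem_of_tendsto hs (Eventually.of_forall h))
  exact hL.eventually_mem hn hs

/-- A convergent sequence of points of the subgroup lies in some `L p`, from a given index on. -/
theorem exists_forall_mem [SequentialSpace G] (hL : IsExhaustion L) {s : ℕ → G}
    {x : G} (h : ∀ k, s k ∈ hL.subgroup) (hs : Tendsto s atTop (𝓝 x)) (m : ℕ) :
    ∃ p ≥ m, ∀ k, s k ∈ L p := by
  obtain ⟨p, hp⟩ := hL.eventually_mem_of_mem_subgroup h hs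
  obtain ⟨b, hb⟩ := eventually_atTop.1 hp
  choose f hf using fun k => hL.mem_subgroup.1 (h k)
  refine ⟨max (max p m) ((Finset.range b).sup f), le_max_of_le_left (le_max_right _ _),
    fun k => ?_⟩
  by_cases hk : b ≤ k
  · exact hL.monotone (le_max_of_le_left (le_max_left _ _)) (hb k hk)
  · refine hL.monotone (le_max_of_le_right ?_) (hf k)
    exact Finset.le_sup (f := f) (Finset.mem_range.2 (not_le.1 hk))

/-- The topology of the subgroup is determined by the sets `L n`. -/
theorem isClosed_of_inter [SequentialSpace G] (hL : IsExhaustion L) {A : Set G}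
    (hA : A ⊆ hL.subgroup) (h : ∀ n, IsClosed (A ∩ L n)) : IsClosed A := by
  refine IsSeqClosed.isClosed fun s x hs hsx => ?_
  obtain ⟨p, hp⟩ := hL.eventually_mem_of_mem_subgroup (fun k => hA (hs k)) hsx
  exact ((h p).mem_of_tendsto hsx (hp.mono fun k hk => ⟨hs k, hk⟩)).1

/-- Each `L n` is first countable at `1`. -/
theorem exists_trace_basis [SequentialSpace G] [T2Space G] (hL : IsExhaustion L)
    {N : ℕ → Set G} (hN : IsCsStarNetworkAt (range N) 1) (hN0 : N 0 = {1}) (n : ℕ) :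
    ∃ V : ℕ → Set G, Antitone V ∧ (∀ j, IsOpen (V j) ∧ 1 ∈ V j) ∧
      ∀ U ∈ 𝓝 (1 : G), ∃ j, V j ∩ L n ⊆ U := by
  refine CountablyBarriered.exists_nhds_basis (L₂ := L (n + 1)) (hL.isClosed n) (hL.one_mem n)
    ?_ ((countablyBarriered_of_isSeqCompact hN hN0 (hL.isSeqCompact (n + 2))).mono ?_)
  · rintro _ ⟨a, ha, b, hb, rfl⟩
    exact hL.mul_mem (by simpa using hL.inv_mem ha) hb
  · rintro _ ⟨a, ha, b, hb, rfl⟩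
    exact hL.mul_mem ha hb

/-- A sequentially compact set is covered by finitely many translates of a neighbourhood
of `1`. -/
theorem _root_.CsStar.exists_finset_subset_mul {K : Set G} (hK : IsSeqCompact K) {V : Set G}
    (hV : V ∈ 𝓝 (1 : G)) : ∃ F : Finset G, (F : Set G) ⊆ K ∧ K ⊆ (F : Set G) * V := by
  by_contra! hcon
  obtain ⟨x, hxK, hx⟩ := exists_seq_of_forall_finset_exists (fun y => y ∈ K)
    (fun p y => p⁻¹ * y ∉ V) (fun s hs => by
      obtain ⟨y, hy, hys⟩ := not_subset.1 (hcon s hs)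
      exact ⟨y, hy, fun p hp h => hys ⟨p, hp, _, h, by simp⟩⟩)
  obtain ⟨a, -, φ, hφ, ha⟩ := hK hxK
  have h : Tendsto (fun k => (x (φ k))⁻¹ * x (φ (k + 1))) atTop (𝓝 1) := by
    simpa using ha.inv.mul (ha.comp (tendsto_add_atTop_nat 1))
  obtain ⟨k, hk⟩ := (h.eventually hV).exists
  exact hx _ _ (hφ k.lt_succ_self) hk

/-- Each `L n` is second countable: the translates of a countable neighbourhood base at `1` by
finite nets yield a countable base. -/
theorem exists_countable_base [SequentialSpace G] [T2Space G] (hL : IsExhaustion L)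
    {N : ℕ → Set G} (hN : IsCsStarNetworkAt (range N) 1) (hN0 : N 0 = {1}) (n : ℕ) :
    ∃ 𝒪 : Set (Set G), 𝒪.Countable ∧ (∀ O ∈ 𝒪, IsOpen O) ∧
      ∀ W, IsOpen W → ∀ x ∈ W, x ∈ L n → ∃ O ∈ 𝒪, x ∈ O ∧ O ∩ L n ⊆ W := by
  obtain ⟨V, -, hV, hVU⟩ := hL.exists_trace_basis hN hN0 (n + 1)
  choose F hFL hF using fun j => exists_finset_subset_mul (hL.isSeqCompact n)
    ((hV j).1.mem_nhds (hV j).2)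
  refine ⟨⋃ j, ⋃ f ∈ F j, {f • V j}, ?_, ?_, ?_⟩
  · exact countable_iUnion fun j => (F j).countable_toSet.biUnion fun f _ => countable_singleton _
  · intro O hO
    simp only [mem_iUnion, mem_singleton_iff] at hO
    obtain ⟨j, f, -, rfl⟩ := hO
    exact (hV j).1.smul f
  · intro W hW x hxW hxL
    have hW' : (fun y => x * y) ⁻¹' W ∈ 𝓝 (1 : G) :=
      (hW.preimage (continuous_const_mul x)).mem_nhds (by simpa using hxW)
    obtain ⟨V', hV'o, hV'1, hV'W⟩ := exists_isOpen_closure_inv_mul_subset hW'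
    obtain ⟨j, hj⟩ := hVU V' (hV'o.mem_nhds hV'1)
    obtain ⟨f, hf, v, hv, rfl⟩ := hF j hxL
    refine ⟨f • V j, ?_, ⟨v, hv, rfl⟩, ?_⟩
    · simp only [mem_iUnion, mem_singleton_iff]
      exact ⟨j, f, hf, rfl⟩
    · rintro _ ⟨⟨w, hw, rfl⟩, hwL⟩
      have hv' : v ∈ V' := hj ⟨hv, by simpa using hL.inv_mul_mem (hFL j hf) hxL⟩
      have hw' : w ∈ V' := hj ⟨hw, by simpa using hL.inv_mul_mem (hFL j hf) hwL⟩
      have := hV'W (subset_closure (mul_mem_mul (inv_mem_inv.2 hv') hw'))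
      simpa [mul_assoc] using this

end IsExhaustion

/-! ### Transfinite sequential closures -/

section IterSeqClosure

variable {X : Type u} [TopologicalSpace X]

theorem mem_iterSeqClosure_iff {A : Set X} {α : Ordinal.{u}} (hα : α ≠ 0) {x : X} :
    x ∈ iterSeqClosure A α ↔ ∃ β < α, x ∈ seqClosure (iterSeqClosure A β) := by
  rw [iterSeqClosure_of_ne_zero A hα]
  simp

theorem seqClosure_iterSeqClosure_subset (A : Set X) {α β : Ordinal.{u}} (h : β < α) :
    seqClosure (iterSeqClosure A β) ⊆ iterSeqClosure A α :=
  fun _ hx => (mem_iterSeqClosure_iff (pos_of_gt h).ne').2 ⟨β, h, hx⟩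

theorem iterSeqClosure_mono (A : Set X) {α β : Ordinal.{u}} (h : β ≤ α) :
    iterSeqClosure A β ⊆ iterSeqClosure A α := by
  rcases h.eq_or_lt with rfl | h
  · rfl
  · exact subset_seqClosure.trans (seqClosure_iterSeqClosure_subset A h)

theorem iterSeqClosure_subset_closure (A : Set X) (α : Ordinal.{u}) :
    iterSeqClosure A α ⊆ closure A := by
  induction α using WellFoundedLT.induction with
  | ind α ih =>
    rcases eq_or_ne α 0 with rfl | hα
    · rw [iterSeqClosure_zero]
      exact subset_closure
    · intro x hx
      obtain ⟨β, hβ, hx⟩ := (mem_iterSeqClosure_iff hα).1 hx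
      exact closure_minimal (ih β hβ) isClosed_closure (seqClosure_subset_closure hx)

/-- Transfinite sequential closures can be computed locally and are compatible with continuous
maps. -/
theorem map_mem_iterSeqClosure {Y : Type u} [TopologicalSpace Y] {f : X → Y} (hf : Continuous f)
    {A O : Set X} {B : Set Y} (hO : IsOpen O) (hAB : ∀ x ∈ A, x ∈ O → f x ∈ B) {α : Ordinal.{u}}
    {x : X} (hx : x ∈ iterSeqClosure A α) (hxO : x ∈ O) : f x ∈ iterSeqClosure B α := by
  induction α using WellFoundedLT.induction generalizing x with
  | ind α ih =>
    rcases eq_or_ne α 0 with rfl | hα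
    · rw [iterSeqClosure_zero] at hx ⊢
      exact hAB x hx hxO
    · obtain ⟨β, hβ, s, hs, hsx⟩ := (mem_iterSeqClosure_iff hα).1 hx
      obtain ⟨b, hb⟩ := eventually_atTop.1 (hsx.eventually (hO.mem_nhds hxO))
      refine (mem_iterSeqClosure_iff hα).2 ⟨β, hβ, fun k => f (s (k + b)), fun k => ?_, ?_⟩
      · exact ih β hβ (hs _) (hb _ (Nat.le_add_left _ _))
      · exact (hf.tendsto x).comp (hsx.comp (tendsto_add_atTop_nat b))

/-- The iteration stops at the first uncountable ordinal, because countably many countable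
ordinals have a countable upper bound. -/
theorem iterSeqClosure_omega_one_add_one (A : Set X) :
    iterSeqClosure A (Ordinal.omega 1 + 1 : Ordinal.{u}) = iterSeqClosure A (Ordinal.omega 1) := by
  refine Subset.antisymm (fun x hx => ?_) (iterSeqClosure_mono A le_self_add)
  have h0 : (Ordinal.omega 1 : Ordinal.{u}) ≠ 0 := (Ordinal.omega_pos 1).ne'
  obtain ⟨β, hβ, s, hs, hsx⟩ := (mem_iterSeqClosure_iff (by simp)).1 hx
  have hs' : ∀ n, ∃ γ < (Ordinal.omega 1 : Ordinal.{u}), s n ∈ seqClosure (iterSeqClosure A γ) :=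
    fun n => (mem_iterSeqClosure_iff h0).1
      (iterSeqClosure_mono A (Order.lt_add_one_iff.1 hβ) (hs n))
  choose γ hγ hγs using hs'
  have hlim : Order.IsSuccLimit (Ordinal.omega 1 : Ordinal.{u}) := Cardinal.isSuccLimit_omega 1
  have hγ' : ∀ n, γ n + 1 < (Ordinal.omega 1 : Ordinal.{u}) := fun n => hlim.add_one_lt (hγ n)
  refine (mem_iterSeqClosure_iff h0).2 ⟨⨆ n, (γ n + 1), Ordinal.iSup_lt_omega_one hγ', s, ?_, hsx⟩
  intro n
  refine iterSeqClosure_mono A (Ordinal.le_iSup (fun n => γ n + 1) n) ?_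
  exact seqClosure_iterSeqClosure_subset A (Order.lt_add_one_iff.2 le_rfl) (hγs n)

theorem iterSeqClosure_one_add_one [FrechetUrysohnSpace X] (A : Set X) :
    iterSeqClosure A (1 + 1 : Ordinal.{u}) = iterSeqClosure A 1 := by
  refine Subset.antisymm ?_ (iterSeqClosure_mono A le_self_add)
  refine (iterSeqClosure_subset_closure A _).trans ?_
  rw [← seqClosure_eq_closure]
  have := seqClosure_iterSeqClosure_subset A (zero_lt_one (α := Ordinal.{u}))
  rwa [iterSeqClosure_zero] at this

end IterSeqClosure

/-- A nonzero countable ordinal is approached by a sequence of smaller ones. -/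
theorem exists_seq_eventually_le {α : Ordinal.{u}} (h0 : α ≠ 0) (hα : α < Ordinal.omega 1) :
    ∃ a : ℕ → Ordinal.{u}, (∀ n, a n < α) ∧ ∀ β < α, ∀ᶠ n in atTop, β ≤ a n := by
  have hc : Countable (Iio α) := by
    rw [← Cardinal.mk_le_aleph0_iff, Cardinal.mk_Iio_ordinal, Cardinal.lift_le_aleph0]
    rw [← Cardinal.ord_aleph, Cardinal.lt_ord, ← Cardinal.succ_aleph0] at hα
    exact Order.lt_succ_iff.1 hα
  have hne : Nonempty (Iio α) := ⟨⟨0, pos_iff_ne_zero.2 h0⟩⟩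
  obtain ⟨f, hf⟩ := exists_surjective_nat (Iio α)
  refine ⟨fun n => (Finset.range (n + 1)).sup' Finset.nonempty_range_add_one
    fun i => (f i : Ordinal.{u}), ?_, ?_⟩
  · intro n
    exact (Finset.sup'_lt_iff _).2 fun i _ => (f i).2
  · intro β hβ
    obtain ⟨i, hi⟩ := hf ⟨β, hβ⟩
    filter_upwards [eventually_ge_atTop i] with n hn
    have := Finset.le_sup' (fun i => (f i : Ordinal.{u}))
      (Finset.mem_range.2 (by omega : i < n + 1))
    exact (congrArg Subtype.val hi).ge.trans this

theorem exists_injective_subseq {X : Type*} [TopologicalSpace X] [T1Space X] {s : ℕ → X} {x : X}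
    (hs : Tendsto s atTop (𝓝 x)) (hx : ∀ n, s n ≠ x) :
    ∃ φ : ℕ → ℕ, StrictMono φ ∧ Function.Injective (s ∘ φ) := by
  obtain ⟨φ, -, hφ⟩ := exists_seq_of_forall_finset (fun _ (_ : ℕ) => True)
    (fun _ p q => p < q ∧ s p ≠ s q) (fun _ t => by
      obtain ⟨y, hy⟩ := ((eventually_all_finset t).2 fun p _ =>
        (eventually_gt_atTop p).and (hs.eventually_ne (hx p).symm)).exists
      exact ⟨y, trivial, fun p hp => ⟨(hy p hp).1, (hy p hp).2.symm⟩⟩)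
  refine ⟨φ, fun m n h => (hφ m n h).1, fun m n h => ?_⟩
  by_contra hne
  rcases lt_or_gt_of_ne hne with hlt | hlt
  · exact (hφ _ _ hlt).2 h
  · exact (hφ _ _ hlt).2 h.symm

section Rank

variable {G : Type u} [Group G] [TopologicalSpace G] [IsTopologicalGroup G] [SequentialSpace G]
  [T2Space G] {L : ℕ → Set G}

/-- For every countable ordinal `α` there are sets from which `1` is reached after exactly `α + 1`
iterations of the sequential closure, provided that no `L m` is a sequential barrier at `1`. Such a
set is glued from translates `x k • A k` of sets of smaller ranks along a sequence `x` converging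
to `1`. The translates are enclosed in closed sets `x k • C k` that meet a given `L r`, for almost
all `k`, in `{x k}` at most. Hence a convergent sequence of points of infinitely many translates is
a subsequence of `x`, and the translates do not interact. -/
theorem exists_iterSeqClosure_rank (hL : IsExhaustion L)
    (hS : ∀ m, ∃ s : ℕ → G, Function.Injective s ∧ (∀ j, s j ∉ L m) ∧ (∀ j, s j ∈ hL.subgroup) ∧
      Tendsto s atTop (𝓝 1)) {α : Ordinal.{u}} (hα : α < Ordinal.omega 1) (m : ℕ) :
    ∃ A C : Set G, A ⊆ C ∧ C ⊆ hL.subgroup ∧ IsClosed C ∧ C ∩ L m ⊆ {1} ∧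
      1 ∈ iterSeqClosure A (α + 1) ∧ 1 ∉ iterSeqClosure A α := by
  induction α using WellFoundedLT.induction generalizing m with
  | ind α ih =>
    obtain ⟨x, hxi, hxm, hxH, hx1⟩ := hS m
    rcases eq_or_ne α 0 with rfl | h0
    · refine ⟨range x, insert 1 (range x), subset_insert _ _, ?_,
        hx1.isCompact_insert_range.isClosed, ?_, ?_, ?_⟩
      · rintro _ (rfl | ⟨j, rfl⟩)
        exacts [one_mem _, hxH j]
      · rintro _ ⟨rfl | ⟨j, rfl⟩, h⟩
        exacts [rfl, absurd h (hxm j)]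
      · refine seqClosure_iterSeqClosure_subset _ (Order.lt_add_one_iff.2 le_rfl) ?_
        rw [iterSeqClosure_zero]
        exact ⟨x, fun j => mem_range_self j, hx1⟩
      · rw [iterSeqClosure_zero]
        rintro ⟨j, hj⟩
        exact hxm j (hj ▸ hL.one_mem m)
    · obtain ⟨a, haα, ha⟩ := exists_seq_eventually_le h0 hα
      obtain ⟨q, hqm, hq⟩ := hL.exists_forall_mem hxH hx1 m
      choose A C hAC hCH hCc hCL hA1 hA0 using
        fun k => ih (a k) (haα k) ((haα k).trans hα) (max q k + 1)
      let D : ℕ → Set G := fun k => x k • C k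
      have hDc : ∀ k, IsClosed (D k) := fun k => (hCc k).smul (x k)
      have hDL : ∀ k, ∀ y ∈ D k, y ∈ L (max q k) → y = x k := by
        rintro k _ ⟨c, hc, rfl⟩ hy
        have h1 : c = 1 := hCL k ⟨hc, by
          simpa using hL.inv_mul_mem (hL.monotone (le_max_left q k) (hq k)) hy⟩
        simp [h1]
      have hDq : ∀ k, ∀ y ∈ D k, y ∈ L q → y = x k :=
        fun k y hy hyq => hDL k y hy (hL.monotone (le_max_left q k) hyq)
      have hDH : ∀ k, D k ⊆ hL.subgroup := by
        rintro k _ ⟨c, hc, rfl⟩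
        exact mul_mem (hxH k) (hCH k hc)
      have h1D : ∀ k, (1 : G) ∉ D k := fun k h =>
        hxm k (hDq k 1 h (hL.one_mem q) ▸ hL.one_mem m)
      -- A convergent sequence that leaves each single `D k` runs along `x`.
      have key : ∀ (J : Set ℕ) (z : ℕ → G) (y : G), Tendsto z atTop (𝓝 y) →
          (∀ i, ∃ k ∈ J, z i ∈ D k) → (∀ k ∈ J, y ∉ D k) →
          ∀ b, ∀ᶠ i in atTop, ∃ k ≥ b, z i = x k := by
        intro J z y hz hzD hy b
        obtain ⟨r, hr⟩ := hL.eventually_mem_of_mem_subgroup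
          (fun i => (hzD i).elim fun k hk => hDH k hk.2) hz
        have hev : ∀ᶠ i in atTop, ∀ k ∈ Finset.range (max b r), k ∈ J → z i ∉ D k := by
          refine (eventually_all_finset _).2 fun k _ => ?_
          by_cases hkJ : k ∈ J
          · filter_upwards [hz.eventually ((hDc k).isOpen_compl.mem_nhds (hy k hkJ))] with i hi _
            exact hi
          · exact Eventually.of_forall fun i h => absurd h hkJ
        filter_upwards [hr, hev] with i hir hi
        obtain ⟨k, hkJ, hk⟩ := hzD i
        have hkb : max b r ≤ k := by
          by_contra! hlt
          exact hi k (Finset.mem_range.2 hlt) hkJ hk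
        exact ⟨k, (le_max_left b r).trans hkb, hDL k _ hk
          (hL.monotone (((le_max_right b r).trans hkb).trans (le_max_right q k)) hir)⟩
      have hEc : ∀ J : Set ℕ, IsClosed (insert 1 (⋃ k ∈ J, D k)) := by
        intro J
        refine IsSeqClosed.isClosed fun z y hz hzy => ?_
        by_contra hy
        simp only [mem_insert_iff, mem_iUnion, not_or, not_exists] at hy
        obtain ⟨b, hb⟩ := eventually_atTop.1 (hzy.eventually_ne hy.1)
        have hz' : ∀ i, ∃ k ∈ J, z (i + b) ∈ D k := by
          intro i
          rcases hz (i + b) with h | h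
          · exact absurd h (hb _ (Nat.le_add_left _ _))
          · simpa using h
        have hzy' := hzy.comp (tendsto_add_atTop_nat b)
        have hk := key J _ y hzy' hz' hy.2
        refine hy.1 (tendsto_nhds_unique hzy' (tendsto_def.2 fun U hU => ?_))
        obtain ⟨c, hc⟩ := eventually_atTop.1 (hx1.eventually hU)
        filter_upwards [hk c] with i ⟨k, hkc, hki⟩
        rw [mem_preimage, hki]
        exact hc k hkc
      have hAD : ∀ k, x k • A k ⊆ D k := fun k => smul_set_mono (hAC k)
      have hsub : (⋃ k, x k • A k) ⊆ insert 1 (⋃ k ∈ univ, D k) := by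
        refine Subset.trans ?_ (subset_insert _ _)
        rw [biUnion_univ]
        exact iUnion_mono hAD
      refine ⟨⋃ k, x k • A k, insert 1 (⋃ k ∈ univ, D k), hsub, ?_, hEc univ, ?_, ?_, ?_⟩
      · refine insert_subset (one_mem hL.subgroup) ?_
        exact iUnion₂_subset fun k _ => hDH k
      · rintro y ⟨rfl | h, hy⟩
        · rfl
        · simp only [mem_univ, iUnion_true, mem_iUnion] at h
          obtain ⟨k, hk⟩ := h
          exact absurd (hDq k y hk (hL.monotone hqm hy) ▸ hy) (hxm k)
      · refine seqClosure_iterSeqClosure_subset _ (Order.lt_add_one_iff.2 le_rfl)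
          ⟨x, fun k => iterSeqClosure_mono _ (Order.add_one_le_iff.2 (haα k)) ?_, hx1⟩
        have := map_mem_iterSeqClosure (f := fun y => x k * y) (B := ⋃ k, x k • A k)
          (continuous_const_mul _) isOpen_univ
          (fun y hy _ => mem_iUnion.2 ⟨k, y, hy, rfl⟩) (hA1 k) (mem_univ _)
        simpa using this
      · intro h1
        -- Consider the first iterate that contains `1`.
        obtain ⟨γ, ⟨hγα, hγ⟩, hmin⟩ := exists_minimal_of_wellFoundedLT
          (fun γ : Ordinal.{u} => γ ≤ α ∧ 1 ∈ iterSeqClosure (⋃ k, x k • A k) γ) ⟨α, le_rfl, h1⟩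
        rcases eq_or_ne γ 0 with rfl | hγ0
        · rw [iterSeqClosure_zero] at hγ
          obtain ⟨k, hk⟩ := mem_iUnion.1 hγ
          exact h1D k (hAD k hk)
        obtain ⟨β, hβγ, z, hz, hz1⟩ := (mem_iterSeqClosure_iff hγ0).1 hγ
        have hβα : β < α := hβγ.trans_le hγα
        have h1β : (1 : G) ∉ iterSeqClosure (⋃ k, x k • A k) β := fun h =>
          hβγ.not_ge (hmin ⟨hβα.le, h⟩ hβγ.le)
        have hzD : ∀ i, ∃ k ∈ univ, z i ∈ D k := by
          intro i
          have := closure_minimal hsub (hEc univ) (iterSeqClosure_subset_closure _ _ (hz i))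
          rcases this with h | h
          · exact absurd (h ▸ hz i) h1β
          · simpa using h
        obtain ⟨b, hb⟩ := eventually_atTop.1 (ha β hβα)
        obtain ⟨i, n, hn, hi⟩ := (key univ z 1 hz1 hzD (fun k _ => h1D k) b).exists
        have hxn : x n ∈ iterSeqClosure (⋃ k, x k • A k) (a n) :=
          iterSeqClosure_mono _ (hb n hn) (hi ▸ hz i)
        -- Near `x n` only the translate `x n • A n` matters.
        have := map_mem_iterSeqClosure (f := fun y => (x n)⁻¹ * y) (B := A n)
          (continuous_const_mul _) (hEc {n}ᶜ).isOpen_compl (fun y hy hyO => ?_) hxn ?_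
        · exact hA0 n (by simpa using this)
        · obtain ⟨k, hk⟩ := mem_iUnion.1 hy
          have hkn : k = n := by
            by_contra hkn
            exact hyO (Or.inr (mem_biUnion (show k ∈ ({n}ᶜ : Set ℕ) from hkn) (hAD k hk)))
          subst hkn
          obtain ⟨c, hc, rfl⟩ := hk
          simpa using hc
        · rintro (h | h)
          · exact hxm n (h ▸ hL.one_mem m)
          · obtain ⟨k, hk, hk'⟩ := mem_iUnion₂.1 h
            exact hk (hxi (hDq k _ hk' (hq n)).symm)

end Rank

/-! ### Character and sb-character -/

section Character

variable {X : Type u} [TopologicalSpace X]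

theorem character_le {κ : Cardinal.{u}}
    (h : ∀ x : X, ∃ ℬ : Set (Set X), IsNhdsBaseAt ℬ x ∧ #ℬ ≤ κ) : character X ≤ κ := by
  refine ciSup_le' fun x => ?_
  obtain ⟨ℬ, hℬ, hκ⟩ := h x
  refine le_trans (csInf_le' ?_) hκ
  exact ⟨ℬ, hℬ, rfl⟩

theorem IsNhdsBaseAt.isSbNetworkAt {ℬ : Set (Set X)} {x : X} (h : IsNhdsBaseAt ℬ x) :
    IsSbNetworkAt ℬ x := by
  refine ⟨fun U hU => ?_, fun B hB s hs => ?_⟩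
  · obtain ⟨B, hB, hBU⟩ := h.2 U hU
    exact ⟨B, hB, (h.1 B hB).2, hBU⟩
  · exact eventually_atTop.1 (hs.eventually ((h.1 B hB).1.mem_nhds (h.1 B hB).2))

theorem exists_isNhdsBaseAt (x : X) : ∃ ℬ : Set (Set X), IsNhdsBaseAt ℬ x :=
  ⟨{U | IsOpen U ∧ x ∈ U}, fun _ h => h, fun _ hU =>
    let ⟨V, hVU, hV, hx⟩ := mem_nhds_iff.1 hU
    ⟨V, ⟨hV, hx⟩, hVU⟩⟩

theorem sbCharacter_le_character : sbCharacter X ≤ character X := by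
  refine ciSup_mono Cardinal.bddAbove_of_small fun x => ?_
  obtain ⟨ℬ, hℬ⟩ := exists_isNhdsBaseAt x
  obtain ⟨ℬ', hℬ', h⟩ := csInf_mem
    (s := {κ | ∃ ℬ : Set (Set X), IsNhdsBaseAt ℬ x ∧ #ℬ = κ}) ⟨_, ℬ, hℬ, rfl⟩
  exact csInf_le' ⟨ℬ', hℬ'.isSbNetworkAt, h⟩

theorem le_sbCharacter {κ : Cardinal.{u}} (x : X)
    (h : ∀ 𝒩 : Set (Set X), IsSbNetworkAt 𝒩 x → κ ≤ #𝒩) : κ ≤ sbCharacter X := by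
  refine le_trans ?_ (le_ciSup Cardinal.bddAbove_of_small x)
  obtain ⟨ℬ, hℬ⟩ := exists_isNhdsBaseAt x
  refine le_csInf ⟨_, ℬ, hℬ.isSbNetworkAt, rfl⟩ ?_
  rintro _ ⟨𝒩, h𝒩, rfl⟩
  exact h 𝒩 h𝒩

theorem one_le_sbCharacter [Nonempty X] : 1 ≤ sbCharacter X := by
  inhabit X
  refine le_sbCharacter default fun 𝒩 h𝒩 => ?_
  obtain ⟨N, hN, -⟩ := h𝒩.1 univ univ_mem
  rw [Cardinal.one_le_iff_ne_zero, Cardinal.mk_ne_zero_iff]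
  exact ⟨⟨N, hN⟩⟩

/-- In a sequential `T₁` space a point with a finite sb-network is isolated. -/
theorem aleph0_le_sbCharacter [SequentialSpace X] [T1Space X] {x : X}
    (hx : ¬ IsOpen ({x} : Set X)) : ℵ₀ ≤ sbCharacter X := by
  refine le_sbCharacter x fun 𝒩 h𝒩 => ?_
  by_contra! hlt
  have hfin : 𝒩.Finite := Cardinal.lt_aleph0_iff_set_finite.1 hlt
  refine hx ?_
  rw [← isClosed_compl_iff]
  refine IsSeqClosed.isClosed fun s y hs hsy => ?_
  rintro rfl
  have hev : ∀ᶠ n in atTop, ∀ N ∈ 𝒩, s n ∈ N :=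
    (eventually_all_finite hfin).2 fun N hN => eventually_atTop.2 (h𝒩.2 N hN s hsy)
  obtain ⟨n, hn⟩ := hev.exists
  obtain ⟨N, hN, -, hNs⟩ := h𝒩.1 {s n}ᶜ (isOpen_compl_singleton.mem_nhds fun h => hs n h.symm)
  exact hNs (hn N hN) rfl

theorem character_le_one [DiscreteTopology X] : character X ≤ 1 := by
  refine character_le fun x => ⟨{{x}}, ⟨?_, fun U hU => ⟨{x}, rfl, ?_⟩⟩, by simp⟩
  · rintro _ rfl
    exact ⟨isOpen_discrete _, rfl⟩
  · exact singleton_subset_iff.2 (mem_of_mem_nhds hU)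

theorem character_le_aleph0 [FirstCountableTopology X] : character X ≤ ℵ₀ := by
  refine character_le fun x => ?_
  obtain ⟨V, hV⟩ := (nhds_basis_opens x).exists_antitone_subbasis
  refine ⟨range V, ⟨?_, fun U hU => ?_⟩, Cardinal.mk_le_aleph0_iff.2 (countable_range V).to_subtype⟩
  · rintro _ ⟨n, rfl⟩
    exact ⟨(hV.1 n).2, (hV.1 n).1⟩
  · obtain ⟨n, hn⟩ := hV.2.mem_iff.1 hU
    exact ⟨V n, mem_range_self n, hn⟩

end Character

section GroupCharacter

variable {G : Type u} [Group G] [TopologicalSpace G] [IsTopologicalGroup G]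

/-- By homogeneity the character can be estimated at `1`. -/
theorem character_le_of_isNhdsBaseAt_one {ℬ : Set (Set G)} (h : IsNhdsBaseAt ℬ (1 : G)) :
    character G ≤ #ℬ := by
  refine character_le fun x => ⟨(x • ·) '' ℬ, ⟨?_, fun U hU => ?_⟩, Cardinal.mk_image_le⟩
  · rintro _ ⟨B, hB, rfl⟩
    exact ⟨(h.1 B hB).1.smul x, 1, (h.1 B hB).2, by simp⟩
  · obtain ⟨B, hB, hBU⟩ := h.2 (x⁻¹ • U) (by
      simpa using smul_mem_nhds_smul x⁻¹ hU)
    exact ⟨x • B, mem_image_of_mem _ hB, smul_set_subset_iff_subset_inv_smul_set.2 hBU⟩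

variable [SequentialSpace G]

theorem CountablyBarriered.firstCountableTopology
    (h : CountablyBarriered (univ : Set G)) : FirstCountableTopology G := by
  obtain ⟨V, -, hV, hVU⟩ := CountablyBarriered.exists_nhds_basis (L := univ) (L₂ := univ)
    isClosed_univ (mem_univ (1 : G)) (subset_univ _) (h.mono (subset_univ _))
  have h1 : (𝓝 (1 : G)).IsCountablyGenerated := by
    refine HasBasis.isCountablyGenerated (p := fun _ : ℕ => True) (s := V) ⟨fun U => ?_⟩
    refine ⟨fun hU => ?_, fun ⟨n, _, hn⟩ => mem_of_superset ((hV n).1.mem_nhds (hV n).2) hn⟩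
    obtain ⟨n, hn⟩ := hVU U hU
    exact ⟨n, trivial, by simpa using hn⟩
  refine ⟨fun x => ?_⟩
  rw [← map_mul_left_nhds_one x]
  infer_instance

variable [T2Space G] {L : ℕ → Set G}

/-- If `1` is not countably barriered, no member of the exhaustion is a barrier at `1`, as each of
them is first countable at `1`. -/
theorem IsExhaustion.exists_injective_seq (hL : IsExhaustion L) {N : ℕ → Set G}
    (hN : IsCsStarNetworkAt (range N) 1) (hN0 : N 0 = {1})
    (hG : ¬ CountablyBarriered (univ : Set G)) (m : ℕ) :
    ∃ s : ℕ → G, Function.Injective s ∧ (∀ j, s j ∉ L m) ∧ (∀ j, s j ∈ hL.subgroup) ∧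
      Tendsto s atTop (𝓝 1) := by
  obtain ⟨V, -, hV, hVU⟩ := hL.exists_trace_basis hN hN0 m
  obtain ⟨s, hs1, hs⟩ : ∃ s : ℕ → G, Tendsto s atTop (𝓝 1) ∧ ∃ᶠ n in atTop, s n ∉ L m := by
    by_contra! hcon
    refine hG ⟨fun j => V j ∩ L m, fun j s _ hs => ?_, hVU⟩
    filter_upwards [hs.eventually ((hV j).1.mem_nhds (hV j).2), hcon s hs]
      with n h1 h2
    exact ⟨h1, h2⟩
  have hH := hs1.eventually (hL.isOpen_subgroup.mem_nhds (Subgroup.one_mem hL.subgroup))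
  obtain ⟨φ, hφ, hφs⟩ := extraction_of_frequently_atTop (hs.and_eventually hH)
  have hφ1 := hs1.comp hφ.tendsto_atTop
  obtain ⟨ψ, hψ, hinj⟩ := exists_injective_subseq hφ1
    (fun n h => (hφs n).1 ((show s (φ n) = 1 from h) ▸ hL.one_mem m))
  exact ⟨_, hinj, fun j => (hφs _).1, fun j => (hφs _).2, hφ1.comp hψ.tendsto_atTop⟩

/-- The sets of products of points of `V i (f i) ∩ L i`, for increasing indices `i`, form a base
of open neighbourhoods of `1` indexed by `f : ℕ → ℕ`, where larger `f` give smaller sets. -/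
theorem IsExhaustion.character_le_dominatingNumber (hL : IsExhaustion L) {N : ℕ → Set G}
    (hN : IsCsStarNetworkAt (range N) 1) (hN0 : N 0 = {1}) :
    character G ≤ dominatingNumber.{u} := by
  choose V hVa hV hVU using hL.exists_trace_basis hN hN0
  let W : (ℕ → ℕ) → ℕ → Set G := fun f n => Nat.rec {1} (fun k A => A * (V k (f k) ∩ L k)) n
  have hW0 : ∀ f, W f 0 = {1} := fun f => rfl
  have hWs : ∀ f k, W f (k + 1) = W f k * (V k (f k) ∩ L k) := fun f k => rfl
  have hmono : ∀ f, Monotone (W f) := fun f => monotone_nat_of_le_succ fun n x hx =>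
    hWs f n ▸ ⟨x, hx, 1, ⟨(hV _ _).2, hL.one_mem _⟩, mul_one x⟩
  have hopen : ∀ f, IsOpen (⋃ n, W f n) := by
    intro f
    rw [← isClosed_compl_iff]
    refine IsSeqClosed.isClosed fun s x hs hsx hx => ?_
    obtain ⟨n, hn⟩ := mem_iUnion.1 hx
    have ht : Tendsto (fun k => x⁻¹ * s k) atTop (𝓝 1) := by simpa using hsx.const_mul x⁻¹
    obtain ⟨p, hp⟩ := hL.isAbsorbing _ ht
    obtain ⟨k, hk1, hk2⟩ := (hp.and (ht.eventually ((hV (max n p) (f (max n p))).1.mem_nhds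
      (hV _ _).2))).exists
    refine hs k (mem_iUnion.2 ⟨max n p + 1, hWs f _ ▸ ⟨x, hmono f (le_max_left n p) hn,
      x⁻¹ * s k, ⟨hk2, hL.monotone (le_max_right n p) hk1⟩, by simp⟩⟩)
  have hanti : ∀ f g, f ≤ g → ∀ n, W g n ⊆ W f n := by
    intro f g hfg n
    induction n with
    | zero => rfl
    | succ k ih =>
      rw [hWs, hWs]
      exact mul_subset_mul ih (inter_subset_inter_left _ (hVa k (hfg k)))
  have hbase : ∀ U ∈ 𝓝 (1 : G), ∃ f, ⋃ n, W f n ⊆ U := by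
    intro U hU
    have hsq : ∀ A : 𝓝 (1 : G) |>.sets, ∃ B : (𝓝 (1 : G)).sets, B.1 * B.1 ⊆ A.1 := by
      rintro ⟨A, hA⟩
      obtain ⟨B, hBo, hB1, hBA⟩ := exists_open_nhds_one_mul_subset hA
      exact ⟨⟨B, hBo.mem_nhds hB1⟩, hBA⟩
    choose q hq using hsq
    let u : ℕ → (𝓝 (1 : G)).sets := fun n => q^[n] ⟨U, hU⟩
    have hu : ∀ n, (u (n + 1)).1 * (u (n + 1)).1 ⊆ (u n).1 := by
      intro n
      have : u (n + 1) = q (u n) := Function.iterate_succ_apply' q n _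
      exact this ▸ hq (u n)
    choose f hf using fun n => hVU n (u (n + 1)).1 (u (n + 1)).2
    refine ⟨f, iUnion_subset fun n => ?_⟩
    have key : ∀ n, W f n * (u n).1 ⊆ U := by
      intro n
      induction n with
      | zero =>
        rw [hW0, singleton_one, one_mul]
        exact Subset.rfl
      | succ k ih =>
        rw [hWs, mul_assoc]
        exact (mul_subset_mul_left ((mul_subset_mul_right (hf k)).trans (hu k))).trans ih
    exact fun x hx => key n ⟨x, hx, 1, mem_of_mem_nhds (u n).2, mul_one x⟩
  obtain ⟨D, hD, hDc⟩ := Order.exists_cof_eq (ℕ → ℕ)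
  refine (character_le_of_isNhdsBaseAt_one (ℬ := (fun f => ⋃ n, W f n) '' D) ⟨?_, ?_⟩).trans ?_
  · rintro _ ⟨f, -, rfl⟩
    exact ⟨hopen f, mem_iUnion.2 ⟨0, rfl⟩⟩
  · intro U hU
    obtain ⟨f, hf⟩ := hbase U hU
    obtain ⟨g, hg, hfg⟩ := hD f
    exact ⟨_, mem_image_of_mem _ hg, (iUnion_mono (hanti f g hfg)).trans hf⟩
  · rw [dominatingNumber, ← hDc]
    simpa using Cardinal.mk_image_le_lift (f := fun f => ⋃ n, W f n) (s := D)

/-- Choose sequences `s n` that converge to `1` outside `L n`. Picking finitely many terms of each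
gives a closed set, so its complement contains a barrier; the positions from which on the sequences
stay in the barriers of an sb-network thus form a dominating family. -/
theorem IsExhaustion.dominatingNumber_le_sbCharacter (hL : IsExhaustion L)
    (hS : ∀ m, ∃ s : ℕ → G, Function.Injective s ∧ (∀ j, s j ∉ L m) ∧ (∀ j, s j ∈ hL.subgroup) ∧
      Tendsto s atTop (𝓝 1)) : dominatingNumber.{u} ≤ sbCharacter G := by
  refine le_sbCharacter 1 fun 𝒩 h𝒩 => ?_
  choose s _ hsL hsH hs1 using hS
  choose F hF using fun (B : 𝒩) n => h𝒩.2 B.1 B.2 (s n) (hs1 n)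
  have hcof : IsCofinal (range F) := by
    intro f
    let A : Set G := {a | ∃ n, ∃ j < f n, a = s n j}
    have hA : IsClosed A := by
      refine hL.isClosed_of_inter ?_ fun m => Set.Finite.isClosed ?_
      · rintro _ ⟨n, j, -, rfl⟩
        exact hsH n j
      · refine ((finite_Iio m).biUnion fun n _ => (finite_Iio (f n)).image (s n)).subset ?_
        rintro _ ⟨⟨n, j, hj, rfl⟩, hm⟩
        have hnm : n < m := by
          by_contra! hle
          exact hsL n j (hL.monotone hle hm)
        exact mem_biUnion hnm (mem_image_of_mem _ hj)
    have h1 : (1 : G) ∉ A := by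
      rintro ⟨n, j, -, h⟩
      exact hsL n j (h ▸ hL.one_mem n)
    obtain ⟨B, hB, -, hBA⟩ := h𝒩.1 Aᶜ (hA.isOpen_compl.mem_nhds h1)
    refine ⟨_, mem_range_self ⟨B, hB⟩, fun n => ?_⟩
    by_contra! hlt
    exact hBA (hF ⟨B, hB⟩ n _ le_rfl) ⟨n, _, hlt, rfl⟩
  have h1 := Cardinal.lift_le.{u}.2 (Order.cof_le hcof)
  refine h1.trans ?_
  simpa using Cardinal.mk_range_le_lift (f := F)

end GroupCharacter

/-! ### Comparisons between global cardinal invariants -/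

section Spaces

variable {X : Type u} [TopologicalSpace X]

theorem card_le_cellularity {𝒰 : Set (Set X)} (h : ∀ U ∈ 𝒰, IsOpen U ∧ U.Nonempty)
    (hd : 𝒰.PairwiseDisjoint id) : #𝒰 ≤ cellularity X :=
  csInf_mem (s := {κ | ∀ 𝒰 : Set (Set X), (∀ U ∈ 𝒰, IsOpen U ∧ U.Nonempty) →
    𝒰.PairwiseDisjoint id → #𝒰 ≤ κ}) ⟨_, fun 𝒰 _ _ => Cardinal.mk_set_le 𝒰⟩ 𝒰 h hd

theorem card_le_extent {D : Set X} (h : IsClosed D) (hd : DiscreteTopology D) :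
    #D ≤ extent X :=
  csInf_mem (s := {κ | ∀ D : Set X, IsClosed D → DiscreteTopology D → #D ≤ κ})
    ⟨_, fun D _ _ => Cardinal.mk_set_le D⟩ D h hd

theorem exists_subcover_card_le {𝒰 : Set (Set X)} (h : ∀ U ∈ 𝒰, IsOpen U) (hc : ⋃₀ 𝒰 = univ) :
    ∃ 𝒱 ⊆ 𝒰, ⋃₀ 𝒱 = univ ∧ #𝒱 ≤ lindelofNumber X :=
  csInf_mem (s := {κ | ∀ 𝒰 : Set (Set X), (∀ U ∈ 𝒰, IsOpen U) → ⋃₀ 𝒰 = univ →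
    ∃ 𝒱 ⊆ 𝒰, ⋃₀ 𝒱 = univ ∧ #𝒱 ≤ κ})
    ⟨_, fun 𝒰 _ hc => ⟨𝒰, Subset.rfl, hc, Cardinal.mk_set_le 𝒰⟩⟩ 𝒰 h hc

theorem cellularity_le_density : cellularity X ≤ density X := by
  obtain ⟨D, hD, hκ⟩ := csInf_mem (s := {κ | ∃ D : Set X, Dense D ∧ #D = κ})
    ⟨_, univ, dense_univ, rfl⟩
  refine csInf_le' fun 𝒰 h𝒰 hd => ?_
  rw [density, ← hκ]
  choose f hfD using fun U : 𝒰 => hD.inter_open_nonempty U (h𝒰 U U.2).1 (h𝒰 U U.2).2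
  refine Cardinal.mk_le_of_injective (f := fun U : 𝒰 => (⟨f U, (hfD U).2⟩ : D)) ?_
  intro U V h
  by_contra hne
  have h' : f U = f V := congrArg Subtype.val h
  exact disjoint_left.1 (hd U.2 V.2 (Subtype.coe_ne_coe.2 hne)) (hfD U).1
    (h' ▸ (hfD V).1)

theorem exists_isNetwork_card : ∃ 𝒩 : Set (Set X), IsNetwork 𝒩 ∧ #𝒩 = networkWeight X :=
  csInf_mem (s := {κ | ∃ 𝒩 : Set (Set X), IsNetwork 𝒩 ∧ #𝒩 = κ})
    ⟨_, univ, fun U _ _ hx => ⟨U, mem_univ _, hx, Subset.rfl⟩, rfl⟩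

theorem density_le_networkWeight : density X ≤ networkWeight X := by
  obtain ⟨𝒩, h𝒩, hκ⟩ := exists_isNetwork_card (X := X)
  rw [← hκ]
  let f : {N : 𝒩 // N.1.Nonempty} → X := fun N => N.2.some
  have hf : Dense (range f) := by
    refine dense_iff_inter_open.2 fun U hU ⟨x, hx⟩ => ?_
    obtain ⟨N, hN, hxN, hNU⟩ := h𝒩 U hU x hx
    have hne : N.Nonempty := ⟨x, hxN⟩
    exact ⟨_, hNU hne.some_mem, mem_range_self (⟨⟨N, hN⟩, hne⟩ : {N : 𝒩 // N.1.Nonempty})⟩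
  have h1 : density X ≤ #(range f) := csInf_le' ⟨_, hf, rfl⟩
  exact h1.trans (Cardinal.mk_range_le.trans (Cardinal.mk_subtype_le _))

theorem lindelofNumber_le_networkWeight : lindelofNumber X ≤ networkWeight X := by
  obtain ⟨𝒩, h𝒩, hκ⟩ := exists_isNetwork_card (X := X)
  rw [← hκ]
  refine csInf_le' fun 𝒰 h𝒰 hc => ?_
  let f : {N : 𝒩 // ∃ U ∈ 𝒰, N.1 ⊆ U} → Set X := fun N => N.2.choose
  refine ⟨range f, ?_, ?_, Cardinal.mk_range_le.trans (Cardinal.mk_subtype_le _)⟩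
  · rintro _ ⟨N, rfl⟩
    exact N.2.choose_spec.1
  · refine eq_univ_of_forall fun x => ?_
    obtain ⟨U, hU, hxU⟩ := mem_sUnion.1 (hc ▸ mem_univ x)
    obtain ⟨N, hN, hxN, hNU⟩ := h𝒩 U (h𝒰 U hU) x hxU
    let N' : {N : 𝒩 // ∃ U ∈ 𝒰, N.1 ⊆ U} := ⟨⟨N, hN⟩, U, hU, hNU⟩
    exact ⟨f N', mem_range_self _, N'.2.choose_spec.2 hxN⟩

/-- A closed discrete set `D` is covered by the open sets `Dᶜ ∪ {d}`, none of which can be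
omitted. -/
theorem extent_le_lindelofNumber [T1Space X] : extent X ≤ lindelofNumber X := by
  refine csInf_le' fun D hD hDd => ?_
  rcases D.eq_empty_or_nonempty with rfl | ⟨d₀, hd₀⟩
  · simp
  have hopen : ∀ d ∈ D, IsOpen (insert d Dᶜ) := by
    intro d _
    have hcl : IsClosed (D \ {d}) := by
      have h1 : IsClosed (((↑) : D → X) '' {x | x.1 ≠ d}) :=
        hD.isClosedEmbedding_subtypeVal.isClosedMap _ (isClosed_discrete _)
      convert h1 using 1
      ext x
      simp [and_comm]
    convert hcl.isOpen_compl using 1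
    ext x
    simp only [mem_insert_iff, mem_compl_iff, Set.mem_sdiff, mem_singleton_iff]
    tauto
  obtain ⟨𝒱, h𝒱, hc, hκ⟩ := exists_subcover_card_le (𝒰 := (fun d => insert d Dᶜ) '' D)
    (by rintro _ ⟨d, hd, rfl⟩; exact hopen d hd) (by
      refine eq_univ_of_forall fun x => ?_
      by_cases hx : x ∈ D
      · exact ⟨_, mem_image_of_mem _ hx, mem_insert _ _⟩
      · exact ⟨_, mem_image_of_mem _ hd₀, mem_insert_of_mem _ hx⟩)
  refine le_trans ?_ hκ
  have hmem : ∀ d ∈ D, insert d Dᶜ ∈ 𝒱 := by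
    intro d hd
    obtain ⟨V, hV, hdV⟩ := mem_sUnion.1 (hc ▸ mem_univ d)
    obtain ⟨e, he, rfl⟩ := h𝒱 hV
    rcases hdV with rfl | h
    · exact hV
    · exact absurd hd h
  refine Cardinal.mk_le_of_injective (f := fun d : D => (⟨_, hmem d.1 d.2⟩ : 𝒱)) ?_
  intro d e h
  have h' : insert d.1 Dᶜ = insert e.1 Dᶜ := congrArg Subtype.val h
  rcases h' ▸ mem_insert d.1 Dᶜ with h | h
  · exact Subtype.ext h
  · exact absurd d.2 h

theorem networkWeight_le_kNetworkWeight : networkWeight X ≤ kNetworkWeight X := by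
  obtain ⟨𝒩, h𝒩, hκ⟩ := csInf_mem (s := {κ | ∃ 𝒩 : Set (Set X), IsKNetwork 𝒩 ∧ #𝒩 = κ})
    ⟨_, univ, fun U _ K _ hKU => ⟨{U}, subset_univ _, finite_singleton U, by simpa, by simp⟩, rfl⟩
  refine csInf_le' ⟨𝒩, fun U hU x hx => ?_, hκ⟩
  obtain ⟨ℳ, hℳ, -, hxℳ, hℳU⟩ := h𝒩 U hU {x} isCompact_singleton (singleton_subset_iff.2 hx)
  obtain ⟨N, hN, hxN⟩ := hxℳ rfl
  exact ⟨N, hℳ hN, hxN, (subset_sUnion_of_mem hN).trans hℳU⟩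

/-- A family whose members are relative neighbourhoods in compact sets of arbitrary points of open
sets is a `k`-network. -/
theorem isKNetwork_of_nhdsWithin {𝒩 : Set (Set X)}
    (h : ∀ U : Set X, IsOpen U → ∀ K : Set X, IsCompact K → ∀ x ∈ K, x ∈ U →
      ∃ N ∈ 𝒩, N ∈ 𝓝[K] x ∧ N ⊆ U) : IsKNetwork 𝒩 := by
  intro U hU K hK hKU
  refine hK.induction_on (p := fun S => ∃ ℳ ⊆ 𝒩, ℳ.Finite ∧ S ⊆ ⋃₀ ℳ ∧ ⋃₀ ℳ ⊆ U)
    ⟨∅, empty_subset _, finite_empty, empty_subset _, by simp⟩ ?_ ?_ ?_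
  · rintro S S' hS ⟨ℳ, h1, h2, h3, h4⟩
    exact ⟨ℳ, h1, h2, hS.trans h3, h4⟩
  · rintro S S' ⟨ℳ, h1, h2, h3, h4⟩ ⟨ℳ', h1', h2', h3', h4'⟩
    refine ⟨ℳ ∪ ℳ', union_subset h1 h1', h2.union h2', ?_, ?_⟩
    · rw [sUnion_union]
      exact union_subset_union h3 h3'
    · rw [sUnion_union]
      exact union_subset h4 h4'
  · intro x hx
    obtain ⟨N, hN, hNx, hNU⟩ := h U hU K hK x hx (hKU hx)
    exact ⟨N, hNx, {N}, singleton_subset_iff.2 hN, finite_singleton N, by simp, by simpa⟩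

end Spaces

/-! ### The boundedness index -/

section Index

variable {G : Type u} [Group G] [TopologicalSpace G]

theorem exists_mul_eq_univ {U : Set G} (hU : IsOpen U) (hne : U.Nonempty) :
    ∃ F : Set G, #F ≤ boundednessIndex G ∧ F * U = univ :=
  csInf_mem (s := {κ | ∀ U : Set G, IsOpen U → U.Nonempty → ∃ F : Set G, #F ≤ κ ∧ F * U = univ})
    ⟨#(univ : Set G), fun _ _ ⟨u, hu⟩ => ⟨univ, le_rfl, eq_univ_of_forall fun g =>
      ⟨g * u⁻¹, mem_univ _, u, hu, by simp⟩⟩⟩ U hU hne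

theorem kNetworkWeight_le_boundednessIndex_of_discrete [DiscreteTopology G] :
    kNetworkWeight G ≤ boundednessIndex G := by
  obtain ⟨F, hF, hFU⟩ := exists_mul_eq_univ (isOpen_discrete ({1} : Set G)) (singleton_nonempty 1)
  have hFu : F = univ := by simpa using hFU
  have hk : IsKNetwork (range fun x : G => ({x} : Set G)) :=
    isKNetwork_of_nhdsWithin fun U _ K _ x _ hxU =>
      ⟨{x}, mem_range_self x, mem_nhdsWithin_of_mem_nhds (isOpen_discrete _ |>.mem_nhds rfl),
        singleton_subset_iff.2 hxU⟩
  have h1 : kNetworkWeight G ≤ #(range fun x : G => ({x} : Set G)) := csInf_le' ⟨_, hk, rfl⟩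
  refine h1.trans (Cardinal.mk_range_le.trans ?_)
  rw [hFu, Cardinal.mk_univ] at hF
  exact hF

/-- The translates of countably many sets by a net. -/
theorem card_image2_smul_le (h0 : ℵ₀ ≤ boundednessIndex G) {F : Set G}
    (hF : #F ≤ boundednessIndex G) {𝒞 : Set (Set G)} (h𝒞 : 𝒞.Countable) :
    #(image2 (fun (f : G) (C : Set G) => f • C) F 𝒞) ≤ boundednessIndex G := by
  rw [← image_prod]
  refine Cardinal.mk_image_le.trans ?_
  rw [Cardinal.mk_setProd]
  refine (mul_le_mul' (by simpa using hF) (?_ : _ ≤ ℵ₀)).trans ?_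
  · simpa using h𝒞
  · exact (Cardinal.mul_aleph0_eq h0).le

variable [IsTopologicalGroup G]

/-- Maximal separated sets are nets. -/
theorem exists_pairwiseDisjoint_mul_eq_univ {U : Set G} (hU : IsOpen U) (hne : U.Nonempty) :
    ∃ F V : Set G, IsOpen V ∧ 1 ∈ V ∧ V⁻¹ = V ∧ F.PairwiseDisjoint (fun f => f • V) ∧
      F * U = univ := by
  obtain ⟨u, hu⟩ := hne
  have hW : (fun y => y * u) ⁻¹' U ∈ 𝓝 (1 : G) :=
    (hU.preimage (continuous_mul_const u)).mem_nhds (by simpa using hu)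
  obtain ⟨V₀, hV₀, h1, hV₀W⟩ := exists_isOpen_closure_inv_mul_subset hW
  let V : Set G := V₀ ∩ V₀⁻¹
  have hVinv : V⁻¹ = V := by simp [V, inter_comm]
  obtain ⟨F, hF⟩ := zorn_subset {F : Set G | F.PairwiseDisjoint (fun f => f • V)}
    (fun c hc hch => ⟨⋃₀ c, (pairwiseDisjoint_sUnion hch.directedOn).2 hc,
      fun s hs => subset_sUnion_of_mem hs⟩)
  refine ⟨F, V, hV₀.inter hV₀.inv, ⟨h1, by simpa using h1⟩, hVinv, hF.prop, ?_⟩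
  refine eq_univ_of_forall fun g => ?_
  obtain ⟨f, hf, hfg⟩ : ∃ f ∈ F, ¬ Disjoint ((g * u⁻¹) • V) (f • V) := by
    by_contra! hcon
    have hins : insert (g * u⁻¹) F ∈ {F : Set G | F.PairwiseDisjoint (fun f => f • V)} :=
      hF.prop.insert fun f hf _ => hcon f hf
    have hmem := hF.le_of_ge hins (subset_insert _ _) (mem_insert _ _)
    have h1V : (g * u⁻¹) ∈ (g * u⁻¹) • V := ⟨1, ⟨h1, by simpa using h1⟩, by simp⟩
    exact disjoint_left.1 (hcon _ hmem) h1V h1V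
  obtain ⟨y, ⟨v, hv, rfl⟩, w, hw, hvw⟩ := not_disjoint_iff.1 hfg
  refine ⟨f, hf, f⁻¹ * g, ?_, by simp⟩
  have hwv : w * v⁻¹ ∈ V₀⁻¹ * V₀ := mul_mem_mul hw.2 (hv.2 : v⁻¹ ∈ V₀)
  have hvw' : f * w = g * u⁻¹ * v := hvw
  have heq : f⁻¹ * g = w * v⁻¹ * u := by
    have : w = f⁻¹ * (g * u⁻¹ * v) := by rw [← hvw']; simp
    rw [this]
    group
  rw [heq]
  exact hV₀W (subset_closure hwv)

theorem boundednessIndex_le_cellularity : boundednessIndex G ≤ cellularity G := by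
  refine csInf_le' fun U hU hne => ?_
  obtain ⟨F, V, hV, h1, -, hd, hFU⟩ := exists_pairwiseDisjoint_mul_eq_univ hU hne
  refine ⟨F, ?_, hFU⟩
  have hinj : InjOn (fun f => f • V) F := by
    intro f hf g hg h
    by_contra hne
    have h1f : f ∈ f • V := ⟨1, h1, by simp⟩
    exact disjoint_left.1 (hd hf hg hne) h1f ((show f • V = g • V from h).subset h1f)
  rw [← Cardinal.mk_image_eq_of_injOn _ _ hinj]
  refine card_le_cellularity ?_ ?_
  · rintro _ ⟨f, -, rfl⟩
    exact ⟨hV.smul f, f, 1, h1, by simp⟩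
  · rintro _ ⟨f, hf, rfl⟩ _ ⟨g, hg, rfl⟩ hfg
    exact hd hf hg fun h => hfg (by rw [h])

theorem boundednessIndex_le_extent [T1Space G] : boundednessIndex G ≤ extent G := by
  refine csInf_le' fun U hU hne => ?_
  obtain ⟨F, V, hV, h1, hinv, hd, hFU⟩ := exists_pairwiseDisjoint_mul_eq_univ hU hne
  refine ⟨F, ?_, hFU⟩
  have hsub : ∀ x : G, (x • V ∩ F).Subsingleton := by
    rintro x f ⟨⟨v, hv, rfl⟩, hf⟩ g ⟨⟨w, hw, rfl⟩, hg⟩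
    by_contra hne
    have hmem : ∀ v ∈ V, x ∈ (x * v) • V := fun v hv =>
      ⟨v⁻¹, hinv ▸ inv_mem_inv.2 hv, by simp⟩
    exact Set.disjoint_left.1 (hd hf hg hne) (hmem v hv) (hmem w hw)
  have hcd : IsClosed F ∧ IsDiscrete F := by
    rw [isClosed_and_discrete_iff]
    intro x
    rw [Filter.disjoint_principal_right]
    have hx : x • V ∈ 𝓝 x := (hV.smul x).mem_nhds ⟨1, h1, by simp⟩
    have hfin : ((x • V ∩ F) \ {x}).Finite := (hsub x).finite.subset sdiff_subset
    have hx' : ((x • V ∩ F) \ {x})ᶜ ∈ 𝓝 x := hfin.isClosed.isOpen_compl.mem_nhds fun h => h.2 rfl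
    filter_upwards [mem_nhdsWithin_of_mem_nhds hx, mem_nhdsWithin_of_mem_nhds hx',
      self_mem_nhdsWithin] with y h1 h2 h3 h4
    exact h2 ⟨⟨h1, h4⟩, h3⟩
  exact card_le_extent hcd.1 hcd.2.to_subtype

/-- Finitely many translates of small neighbourhoods of `1` cannot cover an infinite group. -/
theorem aleph0_le_boundednessIndex [T1Space G] [Infinite G] : ℵ₀ ≤ boundednessIndex G := by
  by_contra! hlt
  obtain ⟨n, hn⟩ := Cardinal.lt_aleph0.1 hlt
  obtain ⟨T, hT⟩ := Infinite.exists_subset_card_eq G (n + 1)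
  have hfin : (((T : Set G)⁻¹ * (T : Set G)) \ {1}).Finite :=
    (T.finite_toSet.inv.mul T.finite_toSet).subset sdiff_subset
  obtain ⟨V, hVo, hV1, hVW⟩ := exists_isOpen_closure_inv_mul_subset
    (hfin.isClosed.isOpen_compl.mem_nhds fun h : (1 : G) ∈ _ => h.2 rfl)
  obtain ⟨F, hF, hFV⟩ := exists_mul_eq_univ hVo ⟨1, hV1⟩
  choose f hf v hv hfv using fun g : G => (hFV ▸ mem_univ g : g ∈ F * V)
  have hinj : Function.Injective fun t : T => (⟨f t, hf t⟩ : F) := by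
    intro s t h
    by_contra hne
    have h' : f s = f t := congrArg Subtype.val h
    refine hVW (subset_closure (mul_mem_mul (inv_mem_inv.2 (hv s)) (hv t)))
      ⟨⟨(s : G)⁻¹, by simp, t, by simp, ?_⟩, fun h1 => hne (Subtype.ext ?_)⟩
    · have hs : v s = (f s)⁻¹ * s := eq_inv_mul_of_mul_eq (hfv s)
      have ht : v t = (f t)⁻¹ * t := eq_inv_mul_of_mul_eq (hfv t)
      rw [hs, ht, h']
      simp
    · have h2 : v s = v t := by simpa [inv_mul_eq_one] using h1
      rw [← hfv s, ← hfv t, h', h2]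
  have hle := (Cardinal.mk_le_of_injective hinj).trans hF
  rw [hn] at hle
  simp only [Cardinal.mk_coe_finset, hT] at hle
  have := Nat.cast_le.1 hle
  omega

theorem kNetworkWeight_le_boundednessIndex_of_firstCountable [FirstCountableTopology G]
    (h0 : ℵ₀ ≤ boundednessIndex G) : kNetworkWeight G ≤ boundednessIndex G := by
  obtain ⟨V, hV⟩ := (nhds_basis_opens (1 : G)).exists_antitone_subbasis
  choose F hF hFV using fun n => exists_mul_eq_univ (hV.1 n).2 ⟨1, (hV.1 n).1⟩
  have hFu : #(⋃ n, F n) ≤ boundednessIndex G := by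
    have h := Cardinal.mk_iUnion_le_lift F
    simp only [Cardinal.lift_uzero, Cardinal.mk_nat, Cardinal.lift_aleph0] at h
    refine h.trans ((mul_le_mul' h0 (ciSup_le' hF)).trans ?_)
    exact (Cardinal.mul_eq_self h0).le
  refine le_trans (csInf_le' ⟨_, ?_, rfl⟩)
    (card_image2_smul_le h0 hFu (countable_range V))
  refine isKNetwork_of_nhdsWithin fun U hU K _ x _ hxU => ?_
  have hW : (fun y => x * y) ⁻¹' U ∈ 𝓝 (1 : G) :=
    (hU.preimage (continuous_const_mul x)).mem_nhds (by simpa using hxU)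
  obtain ⟨W, hWo, hW1, hWU⟩ := exists_isOpen_closure_inv_mul_subset hW
  obtain ⟨n, hn⟩ := hV.2.mem_iff.1 (hWo.mem_nhds hW1)
  obtain ⟨f, hf, v, hv, rfl⟩ : x ∈ F n * V n := hFV n ▸ mem_univ x
  refine ⟨f • V n, ⟨f, mem_iUnion.2 ⟨n, hf⟩, V n, mem_range_self n, rfl⟩,
    mem_nhdsWithin_of_mem_nhds (((hV.1 n).2.smul f).mem_nhds ⟨v, hv, rfl⟩), ?_⟩
  rintro _ ⟨w, hw, rfl⟩
  have := hWU (subset_closure (mul_mem_mul (inv_mem_inv.2 (hn hv)) (hn hw)))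
  simpa [mul_assoc] using this

variable [SequentialSpace G] [T2Space G] {L : ℕ → Set G}

/-- Compact subsets of the open subgroup lie in some `L n`. -/
theorem IsExhaustion.exists_subset_of_isCompact (hL : IsExhaustion L) {K : Set G}
    (hK : IsCompact K) (hKH : K ⊆ hL.subgroup) : ∃ n, K ⊆ L n := by
  by_contra! hcon
  choose x hxK hxL using fun n => not_subset.1 (hcon n)
  let D : ℕ → Set G := fun m => x '' Ici m
  have hDc : ∀ m, IsClosed (D m) := by
    intro m
    refine hL.isClosed_of_inter ?_ fun n => Set.Finite.isClosed ?_
    · rintro _ ⟨k, -, rfl⟩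
      exact hKH (hxK k)
    · refine ((finite_Iio n).image x).subset ?_
      rintro _ ⟨⟨k, -, rfl⟩, hk⟩
      refine mem_image_of_mem x ?_
      by_contra hle
      exact hxL k (hL.monotone (not_lt.1 hle) hk)
  obtain ⟨y, hy⟩ := IsCompact.nonempty_iInter_of_sequence_nonempty_isCompact_isClosed D
    (fun m => image_mono (Ici_subset_Ici.2 m.le_succ))
    (fun m => ⟨x m, mem_image_of_mem x self_mem_Ici⟩)
    (hK.of_isClosed_subset (hDc 0) (by rintro _ ⟨k, -, rfl⟩; exact hxK k)) hDc
  rw [mem_iInter] at hy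
  have hyH : y ∈ hL.subgroup := by
    obtain ⟨k, -, rfl⟩ := hy 0
    exact hKH (hxK k)
  obtain ⟨p, hp⟩ := hL.mem_subgroup.1 hyH
  obtain ⟨k, hk, rfl⟩ := hy p
  exact hxL k (hL.monotone hk hp)

theorem IsExhaustion.kNetworkWeight_le_boundednessIndex (hL : IsExhaustion L) {N : ℕ → Set G}
    (hN : IsCsStarNetworkAt (range N) 1) (hN0 : N 0 = {1}) (h0 : ℵ₀ ≤ boundednessIndex G) :
    kNetworkWeight G ≤ boundednessIndex G := by
  choose 𝒪 h𝒪c h𝒪o h𝒪 using hL.exists_countable_base hN hN0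
  obtain ⟨F, hF, hFH⟩ := exists_mul_eq_univ hL.isOpen_subgroup ⟨1, hL.subgroup.one_mem⟩
  have hc : (⋃ n, (fun O => O ∩ L n) '' 𝒪 n).Countable :=
    countable_iUnion fun n => (h𝒪c n).image _
  refine le_trans (csInf_le' ⟨_, ?_, rfl⟩) (card_image2_smul_le h0 hF hc)
  refine isKNetwork_of_nhdsWithin fun U hU K hK x hxK hxU => ?_
  obtain ⟨f, hf, h, hh, rfl⟩ : x ∈ F * (hL.subgroup : Set G) := hFH ▸ mem_univ x
  -- The part of `K` in the coset of the point is contained in a translate of one `L n`.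
  have hK' : IsCompact (f⁻¹ • K ∩ hL.subgroup) := (hK.smul f⁻¹).inter_right hL.isClosed_subgroup
  obtain ⟨n, hn⟩ := hL.exists_subset_of_isCompact hK' inter_subset_right
  have hhK : h ∈ f⁻¹ • K := ⟨f * h, hxK, by simp⟩
  obtain ⟨O, hO, hhO, hOU⟩ := h𝒪 n (f⁻¹ • U) (hU.smul f⁻¹) h ⟨f * h, hxU, by simp⟩
    (hn ⟨hhK, hh⟩)
  refine ⟨f • (O ∩ L n), ⟨f, hf, _, mem_iUnion.2 ⟨n, mem_image_of_mem _ hO⟩, rfl⟩, ?_, ?_⟩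
  · refine mem_nhdsWithin.2 ⟨f • (O ∩ hL.subgroup),
      ((h𝒪o n O hO).inter hL.isOpen_subgroup).smul f, ⟨h, ⟨hhO, hh⟩, rfl⟩, ?_⟩
    rintro _ ⟨⟨y, ⟨hyO, hyH⟩, rfl⟩, hyK⟩
    exact ⟨y, ⟨hyO, hn ⟨⟨f * y, hyK, by simp⟩, hyH⟩⟩, rfl⟩
  · rintro _ ⟨y, hy, rfl⟩
    obtain ⟨u, hu, rfl⟩ := hOU hy
    simpa using hu

end Index

/-! ### Sequential groups of countable cs*-character -/

section Final

variable {G : Type u} [Group G] [TopologicalSpace G]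

/-- A countable cs*-network at `1` can be enumerated so as to begin with `{1}`. -/
theorem exists_isCsStarNetworkAt_range (hG : csStarCharacter G ≤ ℵ₀) :
    ∃ N : ℕ → Set G, IsCsStarNetworkAt (range N) 1 ∧ N 0 = {1} := by
  have h1 := (le_ciSup (Cardinal.bddAbove_of_small (s := range fun x : G =>
    sInf {κ | ∃ 𝒩 : Set (Set G), IsCsStarNetworkAt 𝒩 x ∧ #𝒩 = κ})) 1).trans hG
  obtain ⟨𝒩, h𝒩, hκ⟩ := csInf_mem
    (s := {κ | ∃ 𝒩 : Set (Set G), IsCsStarNetworkAt 𝒩 (1 : G) ∧ #𝒩 = κ})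
    ⟨_, univ, fun U hU s hs => ⟨U, mem_univ _, Subset.rfl, by
      obtain ⟨b, hb⟩ := eventually_atTop.1 (hs.eventually hU)
      exact (Set.Ici_infinite b).mono hb⟩, rfl⟩
  have hc : 𝒩.Countable := by
    rw [← Cardinal.le_aleph0_iff_set_countable, hκ]
    exact h1
  obtain ⟨N₀, hN₀⟩ := (hc.insert {1}).exists_eq_range (insert_nonempty _ _)
  refine ⟨fun n => Nat.casesOn n {1} N₀, fun U hU s hs => ?_, rfl⟩
  obtain ⟨N, hN, h⟩ := h𝒩 U hU s hs
  obtain ⟨n, rfl⟩ : N ∈ range N₀ := hN₀ ▸ mem_insert_of_mem _ hN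
  exact ⟨_, ⟨n + 1, rfl⟩, h⟩

variable [IsTopologicalGroup G]

theorem pseudocharacter_le_aleph0 {𝒰 : Set (Set G)} (hc : 𝒰.Countable)
    (ho : ∀ U ∈ 𝒰, IsOpen U) (h : ⋂₀ 𝒰 = {(1 : G)}) : pseudocharacter G ≤ ℵ₀ := by
  refine csInf_le' fun x => ⟨(x • ·) '' 𝒰, ?_, ?_, ?_⟩
  · rintro _ ⟨U, hU, rfl⟩
    exact (ho U hU).smul x
  · ext y
    have hy : x⁻¹ * y ∈ ⋂₀ 𝒰 ↔ x⁻¹ * y = 1 := by rw [h]; rfl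
    rw [inv_mul_eq_one, eq_comm] at hy
    rw [mem_singleton_iff, ← hy]
    simp only [mem_sInter, forall_mem_image, mem_smul_set_iff_inv_smul_mem, smul_eq_mul]
  · exact Cardinal.mk_image_le.trans (Cardinal.le_aleph0_iff_set_countable.2 hc)

theorem pseudocharacter_le_aleph0_of_firstCountable [FirstCountableTopology G] [T1Space G] :
    pseudocharacter G ≤ ℵ₀ := by
  obtain ⟨V, hV⟩ := (nhds_basis_opens (1 : G)).exists_antitone_subbasis
  refine pseudocharacter_le_aleph0 (countable_range V) ?_ (Subset.antisymm (fun y hy => ?_) ?_)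
  · rintro _ ⟨n, rfl⟩
    exact (hV.1 n).2
  · by_contra hne
    obtain ⟨n, hn⟩ := hV.2.mem_iff.1 (isOpen_compl_singleton.mem_nhds (Ne.symm hne : (1 : G) ≠ y))
    exact hn (hy _ (mem_range_self n)) rfl
  · rintro _ rfl _ ⟨n, rfl⟩
    exact (hV.1 n).1

variable [SequentialSpace G] [T2Space G]

theorem IsExhaustion.pseudocharacter_le_aleph0 {L : ℕ → Set G} (hL : IsExhaustion L)
    {N : ℕ → Set G} (hN : IsCsStarNetworkAt (range N) 1) (hN0 : N 0 = {1}) :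
    pseudocharacter G ≤ ℵ₀ := by
  choose V _ hV hVU using hL.exists_trace_basis hN hN0
  refine CsStar.pseudocharacter_le_aleph0
    (𝒰 := insert (hL.subgroup : Set G) (⋃ n, range (V n)))
    ((countable_iUnion fun n => countable_range _).insert _) ?_
    (Subset.antisymm (fun y hy => ?_) ?_)
  · rintro _ (rfl | h)
    · exact hL.isOpen_subgroup
    · obtain ⟨n, j, rfl⟩ := mem_iUnion.1 h
      exact (hV n j).1
  · by_contra hne
    obtain ⟨n, hn⟩ := hL.mem_subgroup.1 (hy _ (mem_insert _ _))
    obtain ⟨j, hj⟩ := hVU n _ (isOpen_compl_singleton.mem_nhds (Ne.symm hne : (1 : G) ≠ y))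
    exact hj ⟨hy _ (mem_insert_of_mem _ (mem_iUnion.2 ⟨n, mem_range_self j⟩)), hn⟩ rfl
  · rintro _ rfl _ (rfl | h)
    · exact hL.subgroup.one_mem
    · obtain ⟨n, j, rfl⟩ := mem_iUnion.1 h
      exact (hV n j).2

end Final

theorem sequentialOrder_eq_one (X : Type u) [TopologicalSpace X] [FrechetUrysohnSpace X] :
    sequentialOrder.{u} X = 1 :=
  le_antisymm (csInf_le' ⟨le_rfl, iterSeqClosure_one_add_one⟩)
    (le_csInf ⟨1, le_rfl, iterSeqClosure_one_add_one⟩ fun _ h => h.1)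

theorem sequentialOrder_eq_omega_one {X : Type u} [TopologicalSpace X]
    (h : ∀ α < (Ordinal.omega 1 : Ordinal.{u}), ∃ A : Set X,
      iterSeqClosure A (α + 1) ≠ iterSeqClosure A α) : sequentialOrder.{u} X = Ordinal.omega 1 := by
  have hmem : (Ordinal.omega 1 : Ordinal.{u}) ∈
      {α : Ordinal.{u} | 1 ≤ α ∧ ∀ A : Set X, iterSeqClosure A (α + 1) = iterSeqClosure A α} :=
    ⟨Order.one_le_iff_pos.2 (Ordinal.omega_pos 1), iterSeqClosure_omega_one_add_one⟩
  refine le_antisymm (csInf_le' hmem) (le_csInf ⟨_, hmem⟩ fun α hα => ?_)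
  by_contra! hlt
  obtain ⟨A, hA⟩ := h α hlt
  exact hA (hα.2 A)

end CsStar

open CsStar in
theorem theorem2 (G : Type u) [Group G] [TopologicalSpace G] [IsTopologicalGroup G] [T1Space G]
    [SequentialSpace G] (hG : CsStar.csStarCharacter G ≤ Cardinal.aleph0) :
    CsStar.pseudocharacter G ≤ Cardinal.aleph0 ∧
    (CsStar.sbCharacter G = CsStar.character G ∧
      CsStar.character G ∈
        ({1, Cardinal.aleph0, CsStar.dominatingNumber} : Set Cardinal.{u})) ∧
    (CsStar.boundednessIndex G = CsStar.cellularity G ∧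
      CsStar.cellularity G = CsStar.density G ∧
      CsStar.density G = CsStar.lindelofNumber G ∧
      CsStar.lindelofNumber G = CsStar.extent G ∧
      CsStar.extent G = CsStar.networkWeight G ∧
      CsStar.networkWeight G = CsStar.kNetworkWeight G) ∧
    CsStar.sequentialOrder G ∈ ({1, Ordinal.omega 1} : Set Ordinal.{u}) := by
  obtain ⟨N, hN, hN0⟩ := exists_isCsStarNetworkAt_range hG
  -- All equalities between the global invariants follow from one inequality.
  have hglobal (h : kNetworkWeight G ≤ boundednessIndex G) :
      boundednessIndex G = cellularity G ∧ cellularity G = density G ∧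
        density G = lindelofNumber G ∧ lindelofNumber G = extent G ∧
        extent G = networkWeight G ∧ networkWeight G = kNetworkWeight G := by
    have h1 := boundednessIndex_le_cellularity (G := G)
    have h2 := cellularity_le_density (X := G)
    have h3 := density_le_networkWeight (X := G)
    have h4 := networkWeight_le_kNetworkWeight (X := G)
    have h5 := boundednessIndex_le_extent (G := G)
    have h6 := extent_le_lindelofNumber (X := G)
    have h7 := lindelofNumber_le_networkWeight (X := G)
    have e1 : boundednessIndex G = networkWeight G :=
      (h1.trans (h2.trans h3)).antisymm (h4.trans h)
    have e2 : kNetworkWeight G = networkWeight G := (h.trans e1.le).antisymm h4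
    have e3 : cellularity G = networkWeight G := (h2.trans h3).antisymm (e1.ge.trans h1)
    have e4 : density G = networkWeight G := h3.antisymm (e3.ge.trans h2)
    have e5 : extent G = networkWeight G := (h6.trans h7).antisymm (e1.ge.trans h5)
    have e6 : lindelofNumber G = networkWeight G := h7.antisymm (e5.ge.trans h6)
    exact ⟨e1.trans e3.symm, e3.trans e4.symm, e4.trans e6.symm, e6.trans e5.symm, e5, e2.symm⟩
  have hinf (h : ¬ DiscreteTopology G) : ℵ₀ ≤ boundednessIndex G := by
    have : Infinite G := not_finite_iff_infinite.1 fun _ => h inferInstance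
    exact aleph0_le_boundednessIndex
  by_cases hcb : CountablyBarriered (univ : Set G)
  · have := hcb.firstCountableTopology
    refine ⟨pseudocharacter_le_aleph0_of_firstCountable, ?_, hglobal ?_,
      Or.inl (sequentialOrder_eq_one G)⟩
    · by_cases hd : DiscreteTopology G
      · have h1 : sbCharacter G = 1 :=
          (sbCharacter_le_character.trans character_le_one).antisymm one_le_sbCharacter
        have h2 : character G = 1 :=
          character_le_one.antisymm (one_le_sbCharacter.trans sbCharacter_le_character)
        exact ⟨h1.trans h2.symm, Or.inl h2⟩
      · have h0 : ℵ₀ ≤ sbCharacter G :=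
          aleph0_le_sbCharacter (x := (1 : G)) fun h =>
            hd (discreteTopology_of_isOpen_singleton_one h)
        have h2 : character G = ℵ₀ :=
          character_le_aleph0.antisymm (h0.trans sbCharacter_le_character)
        exact ⟨sbCharacter_le_character.antisymm (h2.le.trans h0), Or.inr (Or.inl h2)⟩
    · by_cases hd : DiscreteTopology G
      · exact kNetworkWeight_le_boundednessIndex_of_discrete
      · exact kNetworkWeight_le_boundednessIndex_of_firstCountable (hinf hd)
  · obtain ⟨L, hL⟩ := exists_isExhaustion hN hN0 hcb
    have hS := hL.exists_injective_seq hN hN0 hcb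
    have hχ := hL.character_le_dominatingNumber hN hN0
    have hsb := hL.dominatingNumber_le_sbCharacter hS
    refine ⟨hL.pseudocharacter_le_aleph0 hN hN0,
      ⟨sbCharacter_le_character.antisymm (hχ.trans hsb), Or.inr (Or.inr
        (hχ.antisymm (hsb.trans sbCharacter_le_character)))⟩, hglobal ?_, Or.inr ?_⟩
    · refine hL.kNetworkWeight_le_boundednessIndex hN hN0 (hinf fun hd => hcb ?_)
      exact ⟨fun _ => {1}, fun _ s _ hs => hs.eventually ((isOpen_discrete _).mem_nhds rfl),
        fun U hU => ⟨0, singleton_subset_iff.2 (mem_of_mem_nhds hU)⟩⟩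
    · refine sequentialOrder_eq_omega_one fun α hα => ?_
      obtain ⟨A, -, -, -, -, -, h1, h2⟩ := exists_iterSeqClosure_rank hL hS hα 0
      exact ⟨A, fun h => h2 (h ▸ h1)⟩
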